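/- Let $S$ be a complex superspace (algebraic or analytic; more generally, a topological space with a sheaf $\mathcal O_S=\mathcal O_S^+\oplus\mathcal O_S^-$ of supercommutative $\mathbb C$-superalgebras with local stalks). Let $\mathcal V$ be a vector bundle of rank $2m|2n$ on $S$ with a symplectic form, i.e. an even bilinear form $(\cdot,\cdot):\mathcal V\times\mathcal V\to\mathcal O_S$, skew-symmetric in the super sense (skew-symmetric on even sections, symmetric on odd ones), that induces an isomorphism $\mathcal V\to\mathcal V^\vee$. Let $L_1,L_2\subset\mathcal V$ be maximal isotropic subbundles of rank $m|n$; this means that $L_i$ is isotropic and the morphism $\mathcal V/L_i\to L_i^\vee$ induced by the form is an isomorphism. Let $\delta:L_1\to\mathcal V/L_2$ be the natural map and $C=[L_1\xrightarrow{\ \delta\ }\mathcal V/L_2]$, so that $\operatorname{Ber}(C)=\operatorname{Ber}(L_1)\otimes\operatorname{Ber}(\mathcal V/L_2)^{-1}$. Assume that there is an open subset $j:U\hookrightarrow S$ such that $\mathcal O_S\to j_*\mathcal O_U$ is injective and $L_1,L_2$ are transversal over $U$, i.e. $L_1\oplus L_2\to\mathcal V$ is an isomorphism over $U$; let $\theta=\theta(L_1,L_2)=\operatorname{ber}(\delta|_U)$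 be the resulting nowhere vanishing even section of $\operatorname{Ber}(C)^{-1}$ over $U$. Let $s\in S$ be a point such that the even parts of the fibres of $L_1$ and $L_2$ at $s$ satisfy $L_{1,s}^+\cap L_{2,s}^+=0$ in the fibre $\mathcal V_s$. Then there are an open neighbourhood $W$ of $s$, a trivialization $t$ (an even generating section) of the line bundle $\operatorname{Ber}(C)$ over $W$ and an even function $f\in\mathcal O_S(W)$ such that $$\theta^{-1}=f^2\,t\quad\text{over } W\cap U .$$ Furthermore, $f$ belongs to the support ideal $\mathcal I(C)$, i.e. locally on $W$ the endomorphism $f\cdot\operatorname{id}$ of the complex $C$ is homotopic to zero. In other words, $f\delta^{-1}$ is regular near $s$: the morphism $f\delta^{-1}:\mathcal V/L_2\to L_1$ over $W\cap U$ extends to a morphism over $W$. -/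

import Mathlib

open TopologicalSpace Opposite CategoryTheory

universe u

noncomputable section

/-- The structure of a supercommutative ring on a (noncommutative) ring `R`: a decomposition
`R = even ⊕ odd`, compatible with multiplication, such that homogeneous elements commute up to the
usual sign. -/
structure SuperGrading (R : Type u) [Ring R] where
  even : Subring R
  odd : AddSubgroup R
  isCompl : IsCompl even.toAddSubgroup odd
  even_mul_odd : ∀ a ∈ even, ∀ b ∈ odd, a * b ∈ odd
  odd_mul_odd : ∀ a ∈ odd, ∀ b ∈ odd, a * b ∈ even
  even_comm : ∀ a ∈ even, ∀ b, a * b = b * a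
  odd_anticomm : ∀ a ∈ odd, ∀ b ∈ odd, a * b = -(b * a)

namespace SuperGrading

variable {R : Type u} [Ring R] (σ : SuperGrading R)

instance : CommRing σ.even :=
  { (inferInstance : Ring σ.even) with
    mul_comm := fun a b => Subtype.ext (σ.even_comm a a.2 b) }

theorem exists_evenPart (a : R) : ∃ b : σ.even, a - b ∈ σ.odd := by
  have h : a ∈ σ.even.toAddSubgroup ⊔ σ.odd := by
    rw [σ.isCompl.sup_eq_top]; trivial
  obtain ⟨b, hb, c, hc, rfl⟩ := AddSubgroup.mem_sup.1 h
  exact ⟨⟨b, hb⟩, by simpa using hc⟩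

/-- The even component of an element. -/
def evenPart (a : R) : σ.even := (σ.exists_evenPart a).choose

/-- The Berezinian `det (A - B D⁻¹ C) · det(D)⁻¹` of a square block matrix
`[[A, B], [C, D]]` of size `m|n`. It is meant for even invertible matrices: `A`, `D` have even
entries and `B`, `C` odd ones, so that `evenPart` only regards an even entry as an element of the
commutative ring `R⁺`. -/
def ber {m n : ℕ} (N : Matrix (Fin m ⊕ Fin n) (Fin m ⊕ Fin n) R) : σ.even :=
  let D : Matrix (Fin n) (Fin n) σ.even :=
    Matrix.of fun k l => σ.evenPart (N (Sum.inr k) (Sum.inr l))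
  let T : Matrix (Fin m) (Fin m) σ.even :=
    Matrix.of fun i j => σ.evenPart (N (Sum.inl i) (Sum.inl j) -
      ∑ k, ∑ l, N (Sum.inl i) (Sum.inr k) * ((D⁻¹ k l : σ.even) : R) * N (Sum.inr l) (Sum.inl j))
  T.det * Ring.inverse D.det

end SuperGrading

/-- A complex superspace: a topological space with a sheaf of supercommutative `ℂ`-superalgebras
whose stalks are local. Complex superschemes and complex analytic superspaces are of this kind. -/
structure Superspace where
  X : TopCat.{u}
  sheaf : TopCat.Sheaf RingCat.{u} X
  grading : ∀ W : Opens X, SuperGrading (sheaf.presheaf.obj (op W))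
  map_even : ∀ (W W' : Opens X) (h : W' ≤ W), ∀ a ∈ (grading W).even,
    (sheaf.presheaf.map (homOfLE h).op).hom a ∈ (grading W').even
  map_odd : ∀ (W W' : Opens X) (h : W' ≤ W), ∀ a ∈ (grading W).odd,
    (sheaf.presheaf.map (homOfLE h).op).hom a ∈ (grading W').odd
  isLocalRing : ∀ x : X, IsLocalRing (sheaf.presheaf.stalk x)
  /-- The structure of `ℂ`-superalgebras. -/
  ofComplex : ℂ →+* (grading ⊤).even

namespace Superspace

variable (S : Superspace.{u})

/-- The ring of functions on an open subset. -/
abbrev fn (W : Opens S.X) : Type u := S.sheaf.presheaf.obj (op W)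

/-- The commutative ring of even functions on an open subset. -/
abbrev evenFn (W : Opens S.X) : Type u := (S.grading W).even

/-- Restriction of functions. -/
def res {W W' : Opens S.X} (h : W' ≤ W) : S.fn W →+* S.fn W' :=
  (S.sheaf.presheaf.map (homOfLE h).op).hom

/-- Restriction of even functions. -/
def evenRes {W W' : Opens S.X} (h : W' ≤ W) : S.evenFn W →+* S.evenFn W' :=
  ((S.res h).comp (S.grading W).even.subtype).codRestrict (S.grading W').even
    (fun a => S.map_even W W' h a a.2)

end Superspace

/-- A presheaf of supermodules over the structure sheaf of a superspace. -/
structure SuperModule (S : Superspace.{u}) where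
  obj : Opens S.X → Type u
  [addCommGroup : ∀ W, AddCommGroup (obj W)]
  [module : ∀ W, Module (S.fn W) (obj W)]
  res : ∀ {W W' : Opens S.X}, W' ≤ W → (obj W →+ obj W')
  res_self : ∀ (W : Opens S.X) (v : obj W), res (le_refl W) v = v
  res_res : ∀ {W W' W'' : Opens S.X} (h : W' ≤ W) (h' : W'' ≤ W') (v : obj W),
    res h' (res h v) = res (h'.trans h) v
  res_smul : ∀ {W W' : Opens S.X} (h : W' ≤ W) (a : S.fn W) (v : obj W),
    res h (a • v) = S.res h a • res h v
  even : ∀ W, AddSubgroup (obj W)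
  odd : ∀ W, AddSubgroup (obj W)
  isCompl : ∀ W, IsCompl (even W) (odd W)
  res_even : ∀ {W W' : Opens S.X} (h : W' ≤ W), ∀ v ∈ even W, res h v ∈ even W'
  res_odd : ∀ {W W' : Opens S.X} (h : W' ≤ W), ∀ v ∈ odd W, res h v ∈ odd W'
  even_smul_even : ∀ W, ∀ a ∈ (S.grading W).even, ∀ v ∈ even W, a • v ∈ even W
  even_smul_odd : ∀ W, ∀ a ∈ (S.grading W).even, ∀ v ∈ odd W, a • v ∈ odd W
  odd_smul_even : ∀ W, ∀ a ∈ (S.grading W).odd, ∀ v ∈ even W, a • v ∈ odd W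
  odd_smul_odd : ∀ W, ∀ a ∈ (S.grading W).odd, ∀ v ∈ odd W, a • v ∈ even W

attribute [instance] SuperModule.addCommGroup SuperModule.module

namespace SuperModule

variable {S : Superspace.{u}}

/-- The sheaf condition: compatible sections over the members of a cover glue uniquely. -/
def IsSheaf (M : SuperModule S) : Prop :=
  ∀ (ι : Type u) (W : ι → Opens S.X) (v : ∀ i, M.obj (W i)),
    (∀ i j, M.res (inf_le_left : W i ⊓ W j ≤ W i) (v i) =
      M.res (inf_le_right : W i ⊓ W j ≤ W j) (v j)) →
    ∃! w : M.obj (iSup W), ∀ i, M.res (le_iSup W i) w = v i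

/-- A homogeneous frame of rank `p|q` over `W`: `p` even and `q` odd sections over `W` that form a
basis of the sections over every smaller open subset. -/
structure Frame (M : SuperModule S) (p q : ℕ) (W : Opens S.X) where
  vec : Fin p ⊕ Fin q → M.obj W
  even : ∀ i, vec (Sum.inl i) ∈ M.even W
  odd : ∀ j, vec (Sum.inr j) ∈ M.odd W
  linearIndependent : ∀ (W' : Opens S.X) (h : W' ≤ W),
    LinearIndependent (S.fn W') (fun i => M.res h (vec i))
  span_eq_top : ∀ (W' : Opens S.X) (h : W' ≤ W),
    Submodule.span (S.fn W') (Set.range fun i => M.res h (vec i)) = ⊤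

namespace Frame

variable {M : SuperModule S} {p q : ℕ} {W : Opens S.X}

/-- The frame as a basis of the module of sections over `W`. -/
def basis (e : M.Frame p q W) : Module.Basis (Fin p ⊕ Fin q) (S.fn W) (M.obj W) :=
  Module.Basis.mk (v := e.vec)
    (by simpa [M.res_self] using e.linearIndependent W le_rfl)
    (by simpa [M.res_self] using (e.span_eq_top W le_rfl).ge)

/-- Restriction of a frame. -/
def restrict (e : M.Frame p q W) {W' : Opens S.X} (h : W' ≤ W) : M.Frame p q W' where
  vec i := M.res h (e.vec i)
  even i := M.res_even h _ (e.even i)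
  odd j := M.res_odd h _ (e.odd j)
  linearIndependent W'' h' := by simpa [M.res_res] using e.linearIndependent W'' (h'.trans h)
  span_eq_top W'' h' := by simpa [M.res_res] using e.span_eq_top W'' (h'.trans h)

/-- The matrix of a family of sections in a frame: `v j = ∑ i, (e.coords v) j i • e i`. With the
coordinates on the left and the vectors indexed by rows, composition of linear maps corresponds to
multiplication of matrices. -/
def coords (e : M.Frame p q W) (v : Fin p ⊕ Fin q → M.obj W) :
    Matrix (Fin p ⊕ Fin q) (Fin p ⊕ Fin q) (S.fn W) :=
  Matrix.of fun j i => e.basis.repr (v j) i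

end Frame

/-- Local freeness of rank `p|q`. -/
def IsLocallyFree (M : SuperModule S) (p q : ℕ) : Prop :=
  ∀ x : S.X, ∃ W : Opens S.X, x ∈ W ∧ Nonempty (M.Frame p q W)

/-- Even morphisms `M|_W → N|_W`. -/
structure HomOver (W : Opens S.X) (M N : SuperModule S) where
  app : ∀ W' : Opens S.X, W' ≤ W → (M.obj W' →ₗ[S.fn W'] N.obj W')
  app_res : ∀ (W' W'' : Opens S.X) (h : W' ≤ W) (h' : W'' ≤ W') (v : M.obj W'),
    app W'' (h'.trans h) (M.res h' v) = N.res h' (app W' h v)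
  app_even : ∀ (W' : Opens S.X) (h : W' ≤ W), ∀ v ∈ M.even W', app W' h v ∈ N.even W'
  app_odd : ∀ (W' : Opens S.X) (h : W' ≤ W), ∀ v ∈ M.odd W', app W' h v ∈ N.odd W'

/-- Sections over `W` of the dual `M^∨`: linear functionals `M|_W → 𝒪|_W`, of any parity. -/
structure Functional (W : Opens S.X) (M : SuperModule S) where
  app : ∀ W' : Opens S.X, W' ≤ W → (M.obj W' →ₗ[S.fn W'] S.fn W')
  app_res : ∀ (W' W'' : Opens S.X) (h : W' ≤ W) (h' : W'' ≤ W') (v : M.obj W'),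
    app W'' (h'.trans h) (M.res h' v) = S.res h' (app W' h v)

open Classical in
/-- The stalk at a point, as an abelian group. -/
abbrev Stalk (M : SuperModule S) (x : S.X) : Type u :=
  AddCommGroup.DirectLimit (ι := {W : Opens S.X // x ∈ W}ᵒᵈ)
    (fun W => M.obj (OrderDual.ofDual W).1) (fun _ _ h => M.res h)

open Classical in
/-- The germ of a section at a point. -/
def germ (M : SuperModule S) {x : S.X} {W : Opens S.X} (hx : x ∈ W) : M.obj W →+ M.Stalk x :=
  AddCommGroup.DirectLimit.of (ι := {W : Opens S.X // x ∈ W}ᵒᵈ)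
    (fun W => M.obj (OrderDual.ofDual W).1) (fun _ _ h => M.res h) (OrderDual.toDual ⟨W, hx⟩)

/-- The subgroup `𝔪_x M_x` of the stalk, where `𝔪_x` is the maximal ideal of `𝒪_x`. -/
def maximalIdealSMul (M : SuperModule S) (x : S.X) : AddSubgroup (M.Stalk x) :=
  AddSubgroup.closure {ξ | ∃ (W : Opens S.X) (hx : x ∈ W) (a : S.fn W) (v : M.obj W),
    S.sheaf.presheaf.germ W x hx a ∈ nonunits (S.sheaf.presheaf.stalk x) ∧
    ξ = M.germ hx (a • v)}

/-- The fibre `M|_x = M_x / 𝔪_x M_x`. -/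
abbrev Fibre (M : SuperModule S) (x : S.X) : Type u := M.Stalk x ⧸ M.maximalIdealSMul x

/-- The value of a section in the fibre at a point. -/
def value (M : SuperModule S) {x : S.X} {W : Opens S.X} (hx : x ∈ W) (v : M.obj W) : M.Fibre x :=
  QuotientAddGroup.mk (M.germ hx v)

/-- A graded subsheaf of `𝒪`-submodules of `V`. -/
structure Subsheaf (V : SuperModule S) where
  carrier : ∀ W : Opens S.X, Submodule (S.fn W) (V.obj W)
  res_mem : ∀ {W W' : Opens S.X} (h : W' ≤ W), ∀ v ∈ carrier W, V.res h v ∈ carrier W'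
  homogeneous : ∀ W, ∀ v ∈ carrier W, ∃ v₀ ∈ carrier W, ∃ v₁ ∈ carrier W,
    v₀ ∈ V.even W ∧ v₁ ∈ V.odd W ∧ v = v₀ + v₁
  mem_of_local : ∀ (W : Opens S.X) (v : V.obj W),
    (∀ x ∈ W, ∃ (W' : Opens S.X) (h : W' ≤ W), x ∈ W' ∧ V.res h v ∈ carrier W') → v ∈ carrier W

namespace Subsheaf

variable {V : SuperModule S}

/-- The whole of `V`. -/
def whole (V : SuperModule S) : V.Subsheaf where
  carrier _ := ⊤
  res_mem _ _ _ := trivial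
  homogeneous W v _ := by
    have h : v ∈ V.even W ⊔ V.odd W := by rw [(V.isCompl W).sup_eq_top]; trivial
    obtain ⟨b, hb, c, hc, rfl⟩ := AddSubgroup.mem_sup.1 h
    exact ⟨b, trivial, c, trivial, hb, hc, rfl⟩
  mem_of_local _ _ _ := trivial

/-- A subsheaf as a supermodule of its own. -/
def toSuperModule (L : V.Subsheaf) : SuperModule S where
  obj W := L.carrier W
  res {W W'} h := ((V.res h).comp (L.carrier W).toAddSubgroup.subtype).codRestrict
    (L.carrier W').toAddSubgroup (fun v => L.res_mem h v v.2)
  res_self W v := Subtype.ext (V.res_self W v)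
  res_res h h' v := Subtype.ext (V.res_res h h' v)
  res_smul h a v := Subtype.ext (V.res_smul h a v)
  even W := (V.even W).comap (L.carrier W).toAddSubgroup.subtype
  odd W := (V.odd W).comap (L.carrier W).toAddSubgroup.subtype
  isCompl W := by
    constructor
    · rw [AddSubgroup.disjoint_def]
      intro v h₀ h₁
      exact Subtype.ext ((AddSubgroup.disjoint_def.1 (V.isCompl W).disjoint) h₀ h₁)
    · rw [codisjoint_iff, eq_top_iff]
      rintro ⟨v, hv⟩ -
      obtain ⟨v₀, h₀, v₁, h₁, e₀, e₁, rfl⟩ := L.homogeneous W v hv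
      exact AddSubgroup.mem_sup.2 ⟨⟨v₀, h₀⟩, e₀, ⟨v₁, h₁⟩, e₁, rfl⟩
  res_even h v hv := V.res_even h _ hv
  res_odd h v hv := V.res_odd h _ hv
  even_smul_even W a ha v hv := V.even_smul_even W a ha _ hv
  even_smul_odd W a ha v hv := V.even_smul_odd W a ha _ hv
  odd_smul_even W a ha v hv := V.odd_smul_even W a ha _ hv
  odd_smul_odd W a ha v hv := V.odd_smul_odd W a ha _ hv

/-- The quotient `V/L`, as the presheaf `W ↦ V(W)/L(W)`. The quotient sheaf is its sheafification.
When `V` is a sheaf, this presheaf is separated, it agrees with the quotient sheaf on every open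
subset over which it has a frame, every local frame of the quotient sheaf comes locally from a
frame of it, and both have the same morphisms to sheaves: so local freeness of `V/L`, its
Berezinian and its morphisms to a bundle may be read off from it. -/
def quotient (L : V.Subsheaf) : SuperModule S where
  obj W := V.obj W ⧸ L.carrier W
  res {W W'} h := QuotientAddGroup.map (L.carrier W).toAddSubgroup (L.carrier W').toAddSubgroup
    (V.res h) (fun v hv => L.res_mem h v hv)
  res_self W v := by
    induction v using Submodule.Quotient.induction_on with
    | H v => exact congrArg Submodule.Quotient.mk (V.res_self W v)
  res_res h h' v := by
    induction v using Submodule.Quotient.induction_on with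
    | H v => exact congrArg Submodule.Quotient.mk (V.res_res h h' v)
  res_smul h a v := by
    induction v using Submodule.Quotient.induction_on with
    | H v => exact congrArg Submodule.Quotient.mk (V.res_smul h a v)
  even W := (V.even W).map (L.carrier W).mkQ.toAddMonoidHom
  odd W := (V.odd W).map (L.carrier W).mkQ.toAddMonoidHom
  isCompl W := by
    constructor
    · rw [AddSubgroup.disjoint_def]
      rintro _ ⟨v, hv, rfl⟩ ⟨w, hw, h⟩
      have h' : w - v ∈ L.carrier W := (Submodule.Quotient.eq _).1 h
      obtain ⟨v₀, h₀, v₁, h₁, e₀, e₁, e⟩ := L.homogeneous W _ h'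
      have key : v + v₀ = w - v₁ := by
        rw [eq_sub_iff_add_eq, add_assoc, ← e]; abel
      have hz : v + v₀ = 0 := (AddSubgroup.disjoint_def.1 (V.isCompl W).disjoint)
        (add_mem hv e₀) (key ▸ sub_mem hw e₁)
      have : v ∈ L.carrier W := by
        rw [eq_neg_of_add_eq_zero_left hz]; exact neg_mem h₀
      exact (Submodule.Quotient.mk_eq_zero _).2 this
    · rw [codisjoint_iff, ← AddSubgroup.map_sup, (V.isCompl W).sup_eq_top]
      exact AddSubgroup.map_top_of_surjective _ (Submodule.mkQ_surjective _)
  res_even h := by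
    rintro _ ⟨v, hv, rfl⟩
    exact ⟨_, V.res_even h v hv, rfl⟩
  res_odd h := by
    rintro _ ⟨v, hv, rfl⟩
    exact ⟨_, V.res_odd h v hv, rfl⟩
  even_smul_even W a ha := by
    rintro _ ⟨v, hv, rfl⟩
    exact ⟨_, V.even_smul_even W a ha v hv, rfl⟩
  even_smul_odd W a ha := by
    rintro _ ⟨v, hv, rfl⟩
    exact ⟨_, V.even_smul_odd W a ha v hv, rfl⟩
  odd_smul_even W a ha := by
    rintro _ ⟨v, hv, rfl⟩
    exact ⟨_, V.odd_smul_even W a ha v hv, rfl⟩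
  odd_smul_odd W a ha := by
    rintro _ ⟨v, hv, rfl⟩
    exact ⟨_, V.odd_smul_odd W a ha v hv, rfl⟩

/-- `L` is a subbundle of `V` of rank `p|q` and corank `p'|q'`. -/
def IsSubbundle (L : V.Subsheaf) (p q p' q' : ℕ) : Prop :=
  L.toSuperModule.IsLocallyFree p q ∧ L.quotient.IsLocallyFree p' q'

/-- The even part `L_x⁺` of the fibre of `L` at `x`, as a subset of the fibre of `V`. -/
def fibreEven (L : V.Subsheaf) (x : S.X) : Set (V.Fibre x) :=
  {ξ | ∃ (W : Opens S.X) (hx : x ∈ W) (v : V.obj W),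
    v ∈ L.carrier W ∧ v ∈ V.even W ∧ ξ = V.value hx v}

/-- `L₁` and `L₂` are transversal over `U`: the map `L₁ ⊕ L₂ → V` is an isomorphism over `U`. -/
def TransversalOver (L₁ L₂ : V.Subsheaf) (U : Opens S.X) : Prop :=
  ∀ W : Opens S.X, W ≤ U → IsCompl (L₁.carrier W) (L₂.carrier W)

/-- The natural map `δ : L₁ → V/L₂`, the differential of the complex `C(V; L₁, L₂)`. -/
def delta (L₁ L₂ : V.Subsheaf) : HomOver ⊤ L₁.toSuperModule L₂.quotient where
  app W _ := (L₂.carrier W).mkQ.comp (L₁.carrier W).subtype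
  app_res _ _ _ _ _ := rfl
  app_even _ _ v hv := ⟨v.1, hv, rfl⟩
  app_odd _ _ v hv := ⟨v.1, hv, rfl⟩

end Subsheaf

/-- An even bilinear form on `V` with values in `𝒪` that is skew-symmetric in the super sense:
skew-symmetric on even sections, symmetric on odd ones. -/
structure SkewForm (V : SuperModule S) where
  form : ∀ W : Opens S.X, V.obj W →+ V.obj W →+ S.fn W
  form_res : ∀ {W W' : Opens S.X} (h : W' ≤ W) (v w : V.obj W),
    form W' (V.res h v) (V.res h w) = S.res h (form W v w)
  smul_left : ∀ (W : Opens S.X) (a : S.fn W) (v w : V.obj W), form W (a • v) w = a * form W v w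
  even_even : ∀ W, ∀ v ∈ V.even W, ∀ w ∈ V.even W, form W v w ∈ (S.grading W).even
  even_odd : ∀ W, ∀ v ∈ V.even W, ∀ w ∈ V.odd W, form W v w ∈ (S.grading W).odd
  odd_odd : ∀ W, ∀ v ∈ V.odd W, ∀ w ∈ V.odd W, form W v w ∈ (S.grading W).even
  skew_even : ∀ W, ∀ v ∈ V.even W, ∀ w, form W v w = -form W w v
  symm_odd : ∀ W, ∀ v ∈ V.odd W, ∀ w ∈ V.odd W, form W v w = form W w v

namespace SkewForm

variable {V : SuperModule S} (B : V.SkewForm)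

/-- The functional `l ↦ (l, v)` on `L` is zero. -/
def Annihilates (L : V.Subsheaf) {W : Opens S.X} (v : V.obj W) : Prop :=
  ∀ (W' : Opens S.X) (h : W' ≤ W), ∀ l ∈ L.carrier W', B.form W' l (V.res h v) = 0

/-- The map `V → L^∨`, `v ↦ (·, v)`, is a surjection of sheaves. -/
def SurjectsOntoDual (L : V.Subsheaf) : Prop :=
  ∀ (W : Opens S.X) (φ : Functional W L.toSuperModule), ∀ x ∈ W,
    ∃ (W' : Opens S.X) (h : W' ≤ W) (v : V.obj W'), x ∈ W' ∧
      ∀ (W'' : Opens S.X) (h' : W'' ≤ W') (l : L.carrier W''),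
        φ.app W'' (h'.trans h) l = B.form W'' l (V.res h' v)

/-- The form is symplectic: the induced map `V → V^∨` is an isomorphism of sheaves. -/
def IsSymplectic : Prop :=
  (∀ (W : Opens S.X) (v : V.obj W), B.Annihilates (Subsheaf.whole V) v → v = 0) ∧
    B.SurjectsOntoDual (Subsheaf.whole V)

/-- `L` is maximal isotropic: it is isotropic, and the induced map `V/L → L^∨` is an isomorphism of
sheaves. -/
def IsMaximalIsotropic (L : V.Subsheaf) : Prop :=
  (∀ W, ∀ l ∈ L.carrier W, ∀ l' ∈ L.carrier W, B.form W l l' = 0) ∧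
    (∀ (W : Opens S.X) (v : V.obj W), B.Annihilates L v → v ∈ L.carrier W) ∧
    B.SurjectsOntoDual L

end SkewForm

/-- An even section over `W` of the line bundle `Ber(E) ⊗ Ber(F)⁻¹`, the Berezinian of a complex
`[E → F]` of bundles of rank `m|n`. Local frames `e` of `E` and `g` of `F` give a
generator `[e] ⊗ [g]⁻¹`, where `[e'] = ber(P) [e]` if `e' = P e`; a section is given by its
coefficients `coeff e g` at these generators. -/
structure BerSection (E F : SuperModule S) (m n : ℕ) (W : Opens S.X) where
  coeff : ∀ {W' : Opens S.X}, W' ≤ W → E.Frame m n W' → F.Frame m n W' → S.evenFn W'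
  coeff_res : ∀ {W' W'' : Opens S.X} (h : W' ≤ W) (h' : W'' ≤ W')
    (e : E.Frame m n W') (g : F.Frame m n W'),
    coeff (h'.trans h) (e.restrict h') (g.restrict h') = S.evenRes h' (coeff h e g)
  coeff_change : ∀ {W' : Opens S.X} (h : W' ≤ W)
    (e e' : E.Frame m n W') (g g' : F.Frame m n W'),
    coeff h e g * (S.grading W').ber (g.coords g'.vec) =
      coeff h e' g' * (S.grading W').ber (e.coords e'.vec)

/-- The section generates the line bundle, i.e. it is a trivialization. -/
def BerSection.IsTrivialization {E F : SuperModule S} {m n : ℕ} {W : Opens S.X}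
    (t : BerSection E F m n W) : Prop :=
  ∀ {W' : Opens S.X} (h : W' ≤ W) (e : E.Frame m n W') (g : F.Frame m n W'),
    IsUnit (t.coeff h e g)

/-- The canonical section `θ = ber(d)` of `Ber(E)⁻¹ ⊗ Ber(F)` for an isomorphism `d : E → F` over
an open subset, through its coefficient at `[e]⁻¹ ⊗ [g]`: the Berezinian of the matrix of `d`. -/
def theta {E F : SuperModule S} (d : HomOver ⊤ E F) {m n : ℕ} {W : Opens S.X}
    (e : E.Frame m n W) (g : F.Frame m n W) : S.evenFn W :=
  (S.grading W).ber (g.coords fun j => d.app W le_top (e.vec j))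

/-- The even function `f` on `W` belongs to the support ideal `ℐ(E → F)`: locally, multiplication by
`f` on the complex `[E → F]` is homotopic to zero. -/
def MemSupportIdeal {E F : SuperModule S} (d : HomOver ⊤ E F) {W : Opens S.X}
    (f : S.evenFn W) : Prop :=
  ∀ x ∈ W, ∃ (W' : Opens S.X) (h : W' ≤ W) (k : HomOver W' F E), x ∈ W' ∧
    ∀ (W'' : Opens S.X) (h' : W'' ≤ W'),
      (∀ v : E.obj W'', k.app W'' h' (d.app W'' le_top v) =
        (S.evenRes (h'.trans h) f : S.fn W'') • v) ∧
      (∀ y : F.obj W'', d.app W'' le_top (k.app W'' h' y) =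
        (S.evenRes (h'.trans h) f : S.fn W'') • y)

end SuperModule

end

/-!
In local frames `δ : L₁ → V/L₂` is an even supermatrix `[[A, B], [C, D]]`. Because the even fibres
of `L₁` and `L₂` at `s` are disjoint, `A` is invertible near `s`; bringing the value of `D` in the
residue field to rank normal form, one finds frames in which `δ` is the identity outside an odd
block `X` with `X(s) = 0`. Let `uᵢ` be the corresponding odd frame vectors of `L₁`, let `vⱼ` be odd
lifts of the frame vectors of `V/L₂`, and put `H = (uᵢ, vⱼ)` and `G = (vᵢ, vⱼ)`, where `G` is
symmetric. Since `uᵢ - ∑ Xᵢⱼ vⱼ` lies in `L₂`, isotropy gives `X Hᵀ + H Xᵀ = X G Xᵀ`, so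
`Y = H - ½ X G` makes `X Yᵀ` skew-symmetric. Pairing the `uᵢ` with dual odd sections, which exist
because `V → L₁^∨` is surjective, shows that `H(s) = Y(s)` is invertible. The Pfaffian `f` of
`X Yᵀ` then satisfies `f² = det X · det Y`, with `det Y` a unit, and `f X⁻¹` is regular, being `Yᵀ`
times the Pfaffian adjoint of `X Yᵀ`; `f X⁻¹` also provides the homotopy.
-/

section SkewSymmetric

open Matrix

variable {ι R : Type*} [CommRing R]

theorem apply_self_eq_zero_of_transpose_eq_neg [IsDomain R] (h2 : (2 : R) ≠ 0) {A : Matrix ι ι R}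
    (hA : Aᵀ = -A) (i : ι) : A i i = 0 := by
  have h : A i i = -A i i := congrFun (congrFun hA i) i
  exact (mul_eq_zero.1 (by linear_combination h : 2 * A i i = 0)).resolve_left h2

variable [Fintype ι] [DecidableEq ι]

theorem det_one_add_of_col_eq_zero {P : Matrix ι ι R} {j : ι}
    (hP : ∀ k l, l ≠ j → P k l = 0) : (1 + P).det = 1 + P j j := by
  have h : P = replicateCol Unit (fun k => P k j) * replicateRow Unit (Pi.single j (1 : R)) := by
    ext k l
    rcases eq_or_ne l j with rfl | hl
    · simp [mul_apply]
    · simp [mul_apply, hP k l hl, hl]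
  conv_lhs => rw [h]
  rw [det_one_add_replicateCol_mul_replicateRow, single_one_dotProduct]

theorem transpose_inv_eq_neg {A : Matrix ι ι R} (hA : Aᵀ = -A) (hu : IsUnit A.det) :
    A⁻¹ᵀ = -A⁻¹ := by
  rw [transpose_nonsing_inv, hA]
  exact inv_eq_right_inv (by simp [mul_nonsing_inv _ hu])

theorem transpose_schurComplement_eq_neg {κ : Type*} {P : Matrix ι ι R} {D : Matrix κ κ R}
    (hP : Pᵀ = -P) (hu : IsUnit P.det) (hD : Dᵀ = -D) (Q : Matrix ι κ R) :
    (D + Qᵀ * P⁻¹ * Q)ᵀ = -(D + Qᵀ * P⁻¹ * Q) := by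
  simp only [transpose_add, transpose_mul, transpose_transpose, transpose_inv_eq_neg hP hu, hD,
    Matrix.neg_mul, Matrix.mul_neg, Matrix.mul_assoc, neg_add]

theorem det_fin_two_eq_sq {P : Matrix (Fin 2) (Fin 2) R} (hP : Pᵀ = -P) (h₀ : P 0 0 = 0) :
    P.det = P 0 1 ^ 2 := by
  have h₁₀ : P 1 0 = -P 0 1 := congrFun (congrFun hP 0) 1
  rw [det_fin_two, h₀, h₁₀]
  ring

/-- Reordering of an index type that puts two given distinct indices first. -/
noncomputable def pairFirstEquiv {i j : ι} (hij : i ≠ j) :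
    Fin 2 ⊕ ((Set.range ![i, j])ᶜ : Set ι) ≃ ι :=
  (Equiv.sumCongr (Equiv.ofInjective ![i, j] (injective_pair_iff_ne.2 hij)) (Equiv.refl _)).trans
    (Equiv.Set.sumCompl (Set.range ![i, j]))

/-- Splitting off a nondegenerate `2 × 2` block leaves a skew-symmetric Schur complement. -/
theorem exists_det_eq_sq_mul_det {K : Type*} [Field K] (h2 : (2 : K) ≠ 0) {A : Matrix ι ι K}
    (hA : Aᵀ = -A) {i j : ι} (hij : A i j ≠ 0) :
    ∃ (s : Set ι) (_ : Fintype s) (A' : Matrix s s K), Fintype.card s < Fintype.card ι ∧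
      A'ᵀ = -A' ∧ A.det = A i j ^ 2 * A'.det := by
  have hne : i ≠ j := fun h =>
    hij (h ▸ apply_self_eq_zero_of_transpose_eq_neg h2 hA i)
  let e := pairFirstEquiv hne
  have hblock : ∀ a b, A (e b) (e a) = -A (e a) (e b) := fun a b =>
    congrFun (congrFun hA (e a)) (e b)
  set P := (A.submatrix e e).toBlocks₁₁
  set Q := (A.submatrix e e).toBlocks₁₂
  set D := (A.submatrix e e).toBlocks₂₂
  have hP : Pᵀ = -P := Matrix.ext fun a b => hblock (.inl a) (.inl b)
  have hD : Dᵀ = -D := Matrix.ext fun a b => hblock (.inr a) (.inr b)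
  have hQ : (A.submatrix e e).toBlocks₂₁ = -Qᵀ :=
    Matrix.ext fun a b => hblock (.inl b) (.inr a)
  have hdet : P.det = A i j ^ 2 :=
    det_fin_two_eq_sq hP (apply_self_eq_zero_of_transpose_eq_neg h2 hP 0)
  have hu : IsUnit P.det := hdet ▸ (pow_ne_zero 2 hij).isUnit
  let _ := P.invertibleOfIsUnitDet hu
  refine ⟨_, inferInstance, D + Qᵀ * P⁻¹ * Q, ?_, transpose_schurComplement_eq_neg hP hu hD Q, ?_⟩
  · have h := Fintype.card_congr e
    rw [Fintype.card_sum, Fintype.card_fin] at h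
    omega
  · rw [← det_submatrix_equiv_self e A, ← fromBlocks_toBlocks (A.submatrix e e), hQ,
      det_fromBlocks₁₁, hdet, invOf_eq_nonsing_inv, Matrix.neg_mul, Matrix.neg_mul, sub_neg_eq_add]

theorem isSquare_det_of_transpose_eq_neg {K : Type*} [Field K] (h2 : (2 : K) ≠ 0)
    (A : Matrix ι ι K) (hA : Aᵀ = -A) : IsSquare A.det := by
  classical
  induction hk : Fintype.card ι using Nat.strong_induction_on generalizing ι with
  | _ k ih =>
  subst hk
  by_cases h0 : A = 0
  · subst h0
    rcases isEmpty_or_nonempty ι with h | h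
    · simp
    · simp [det_zero]
  · obtain ⟨i, j, hij⟩ : ∃ i j, A i j ≠ 0 := by
      by_contra! h
      exact h0 (Matrix.ext h)
    obtain ⟨s, _, A', hcard, hA', hdet⟩ := exists_det_eq_sq_mul_det h2 hA hij
    rw [hdet]
    exact (IsSquare.sq _).mul (ih _ hcard A' hA' rfl)

theorem isSquare_of_isSquare_algebraMap (K : Type*) [Field K] [Algebra R K] [IsFractionRing R K]
    [IsIntegrallyClosed R] {a : R} (ha : IsSquare (algebraMap R K a)) : IsSquare a := by
  obtain ⟨c, hc⟩ := ha
  obtain ⟨f, rfl⟩ := IsIntegrallyClosed.exists_algebraMap_eq_of_isIntegral_pow (R := R) (x := c)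
    two_pos (by rw [pow_two, ← hc]; exact isIntegral_algebraMap)
  exact ⟨f, IsFractionRing.injective R K (by rw [hc, map_mul])⟩

theorem isSquare_det_of_transpose_eq_neg_of_isIntegrallyClosed [IsDomain R] [IsIntegrallyClosed R]
    (h2 : (2 : R) ≠ 0) (A : Matrix ι ι R) (hA : Aᵀ = -A) : IsSquare A.det := by
  let K := FractionRing R
  have h2K : (2 : K) ≠ 0 := by
    rw [← map_ofNat (algebraMap R K) 2]
    exact (map_ne_zero_iff _ (IsFractionRing.injective R K)).2 h2
  have hAK : (A.map (algebraMap R K))ᵀ = -A.map (algebraMap R K) := by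
    rw [← transpose_map, hA]
    exact Matrix.ext fun i j => map_neg (algebraMap R K) (A i j)
  refine isSquare_of_isSquare_algebraMap K ?_
  rw [RingHom.map_det]
  exact isSquare_det_of_transpose_eq_neg h2K _ hAK

theorem even_card_of_transpose_eq_neg [IsDomain R] (h2 : (2 : R) ≠ 0) {A : Matrix ι ι R}
    (hA : Aᵀ = -A) (hdet : A.det ≠ 0) : Even (Fintype.card ι) := by
  by_contra hodd
  have h : A.det = -A.det := by
    conv_lhs => rw [← det_transpose, hA, det_neg, (Nat.not_even_iff_odd.1 hodd).neg_one_pow]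
    rw [neg_one_mul]
  exact hdet ((mul_eq_zero.1 (by linear_combination h : 2 * A.det = 0)).resolve_left h2)

theorem transpose_adjugate_of_transpose_eq_neg {A : Matrix ι ι R} (hA : Aᵀ = -A)
    (hι : Even (Fintype.card ι)) : A.adjugateᵀ = -A.adjugate := by
  rcases isEmpty_or_nonempty ι with h | h
  · exact Matrix.ext fun i => isEmptyElim i
  · rw [adjugate_transpose, hA, ← neg_one_smul R A, adjugate_smul,
      (Nat.Even.sub_odd Fintype.card_pos hι odd_one).neg_one_pow, neg_one_smul]

end SkewSymmetric

section JacobiFormula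

open Matrix

variable {ι k R : Type*} [DecidableEq ι] [CommRing k] [CommRing R] [Algebra k R]
  (d : Derivation k R R)

theorem derivation_prod (s : Finset ι) (a : ι → R) :
    d (∏ i ∈ s, a i) = ∑ i ∈ s, (∏ j ∈ s.erase i, a j) * d (a i) := by
  induction s using Finset.induction_on with
  | empty => simp
  | insert i s hi ih =>
    rw [Finset.prod_insert hi, Derivation.leibniz, ih, Finset.sum_insert hi,
      Finset.erase_insert hi, smul_eq_mul, smul_eq_mul, add_comm, Finset.mul_sum]
    refine congrArg _ (Finset.sum_congr rfl fun j hj => ?_)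
    have hij : i ≠ j := fun h => hi (h ▸ hj)
    rw [Finset.erase_insert_of_ne hij, Finset.prod_insert (fun h => hi (Finset.mem_of_mem_erase h)),
      mul_assoc]

theorem derivation_det_eq_sum_det_updateCol [Fintype ι] (A : Matrix ι ι R) :
    d A.det = ∑ i, (A.updateCol i fun j => d (A j i)).det := by
  simp only [det_apply, map_sum]
  rw [Finset.sum_comm]
  refine Finset.sum_congr rfl fun σ _ => ?_
  rw [← Finset.smul_sum, Units.smul_def, Units.smul_def, map_zsmul, derivation_prod]
  refine congrArg _ (Finset.sum_congr rfl fun i _ => ?_)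
  rw [← Finset.mul_prod_erase _ _ (Finset.mem_univ i), mul_comm, updateCol_self]
  refine congrArg _ (Finset.prod_congr rfl fun j hj => ?_)
  rw [updateCol_ne (Finset.ne_of_mem_erase hj)]

theorem derivation_det [Fintype ι] (A : Matrix ι ι R) :
    d A.det = (A.adjugate * A.map d).trace := by
  rw [derivation_det_eq_sum_det_updateCol]
  refine Finset.sum_congr rfl fun i _ => ?_
  rw [← cramer_apply, cramer_eq_adjugate_mulVec]
  rfl

end JacobiFormula

section Pfaffian

open Matrix

variable {ι : Type*} [DecidableEq ι]

/-- The universal skew-symmetric matrix `X_ij - X_ji`. Its coefficients lie in a polynomial ring,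
where Pfaffian identities can be divided by nonzero factors. -/
noncomputable def genericSkewMatrix (ι : Type*) : Matrix ι ι (MvPolynomial (ι × ι) ℤ) :=
  of fun i j => MvPolynomial.X (i, j) - MvPolynomial.X (j, i)

theorem transpose_genericSkewMatrix (ι : Type*) :
    (genericSkewMatrix ι)ᵀ = -genericSkewMatrix ι :=
  Matrix.ext fun _ _ => (neg_sub _ _).symm

theorem map_pderiv_genericSkewMatrix (i j : ι) :
    (genericSkewMatrix ι).map (MvPolynomial.pderiv (i, j)) = single i j 1 - single j i 1 := by
  ext a b : 2
  simp only [genericSkewMatrix, map_apply, of_apply, map_sub, MvPolynomial.pderiv_X,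
    Pi.single_apply, Prod.mk.injEq, Matrix.sub_apply, single_apply]
  congr 1
  simp only [eq_comm, and_comm]

variable [Fintype ι]

/-- Differentiating `det A = f ^ 2` gives `2 adj A = 2 f Q` with `Q` the matrix of partial
derivatives of `f`. -/
theorem adjugate_genericSkewMatrix {f : MvPolynomial (ι × ι) ℤ}
    (hf : (genericSkewMatrix ι).det = f ^ 2) (hι : Even (Fintype.card ι)) :
    (genericSkewMatrix ι).adjugate = f • of fun i j => MvPolynomial.pderiv (j, i) f := by
  set A := genericSkewMatrix ι
  refine Matrix.ext fun i j => ?_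
  have hskew : A.adjugate j i = -A.adjugate i j :=
    congrFun (congrFun (transpose_adjugate_of_transpose_eq_neg (transpose_genericSkewMatrix ι) hι)
      i) j
  have hjacobi := derivation_det (MvPolynomial.pderiv (R := ℤ) (j, i)) A
  rw [map_pderiv_genericSkewMatrix, Matrix.mul_sub, trace_sub, trace_mul_single, trace_mul_single,
    MulOpposite.op_one, one_smul, one_smul, hskew, hf, pow_two, Derivation.leibniz,
    smul_eq_mul] at hjacobi
  refine mul_left_cancel₀ (two_ne_zero (α := MvPolynomial (ι × ι) ℤ)) ?_
  simp only [Matrix.smul_apply, of_apply, smul_eq_mul]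
  linear_combination -hjacobi

theorem exists_pfaffian_genericSkewMatrix :
    ∃ (f : MvPolynomial (ι × ι) ℤ) (Q : Matrix ι ι (MvPolynomial (ι × ι) ℤ)),
      (genericSkewMatrix ι).det = f ^ 2 ∧ genericSkewMatrix ι * Q = f • 1 ∧
        Q * genericSkewMatrix ι = f • 1 := by
  have hskew := transpose_genericSkewMatrix ι
  obtain ⟨f, hf⟩ := isSquare_det_of_transpose_eq_neg_of_isIntegrallyClosed two_ne_zero _ hskew
  rw [← pow_two] at hf
  by_cases hf0 : f = 0
  · exact ⟨0, 0, by simp [hf, hf0], by simp, by simp⟩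
  have hadj := adjugate_genericSkewMatrix hf
    (even_card_of_transpose_eq_neg two_ne_zero hskew (hf ▸ pow_ne_zero 2 hf0))
  refine ⟨f, of fun i j => MvPolynomial.pderiv (j, i) f, hf, smul_right_injective _ hf0 ?_,
    smul_right_injective _ hf0 ?_⟩
  · have h := (genericSkewMatrix ι).mul_adjugate
    rwa [hadj, hf, Matrix.mul_smul, pow_two, mul_smul] at h
  · have h := (genericSkewMatrix ι).adjugate_mul
    rwa [hadj, hf, Matrix.smul_mul, pow_two, mul_smul] at h

theorem exists_pfaffian {R : Type*} [CommRing R] (h2 : IsUnit (2 : R)) (P : Matrix ι ι R)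
    (hP : Pᵀ = -P) :
    ∃ (f : R) (Q : Matrix ι ι R), P.det = f ^ 2 ∧ P * Q = f • 1 ∧ Q * P = f • 1 := by
  obtain ⟨c, hc⟩ := h2.exists_left_inv
  obtain ⟨f, Q, hdet, hPQ, hQP⟩ := exists_pfaffian_genericSkewMatrix (ι := ι)
  let φ : MvPolynomial (ι × ι) ℤ →+* R :=
    (MvPolynomial.aeval fun x : ι × ι => c * P x.1 x.2).toRingHom
  have hφ : φ.mapMatrix (genericSkewMatrix ι) = P := by
    ext i j
    have hs : P j i = -P i j := congrFun (congrFun hP i) j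
    simp only [φ, genericSkewMatrix, RingHom.mapMatrix_apply, map_apply, of_apply, map_sub,
      AlgHom.toRingHom_eq_coe, RingHom.coe_coe, MvPolynomial.aeval_X, hs]
    linear_combination P i j * hc
  have hsmul : φ.mapMatrix (f • (1 : Matrix ι ι (MvPolynomial (ι × ι) ℤ))) = φ f • 1 := by
    rw [smul_one_eq_diagonal, smul_one_eq_diagonal, RingHom.mapMatrix_apply,
      diagonal_map (map_zero φ)]
  refine ⟨φ f, φ.mapMatrix Q, ?_, ?_, ?_⟩
  · rw [← hφ, ← RingHom.map_det, hdet, map_pow]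
  · rw [← hsmul, ← hPQ, map_mul, hφ]
  · rw [← hsmul, ← hQP, map_mul, hφ]

end Pfaffian

section ExtendByOne

open Matrix

variable {ι R : Type*} [DecidableEq ι] (p : ι → Prop) [DecidablePred p]

/-- The extension of a square matrix indexed by the subtype `{i // p i}` to a matrix indexed by `ι`
which is the identity outside the given block. -/
def extendByOne [Zero R] [One R] (X : Matrix {i // p i} {i // p i} R) : Matrix ι ι R :=
  reindex (Equiv.sumCompl p) (Equiv.sumCompl p) (fromBlocks X 0 0 1)

variable {p}

section Smul

variable [Fintype ι] [Ring R] {M : Type*} [AddCommGroup M] [Module R M]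

theorem sum_extendByOne_smul_of_pos (X : Matrix {i // p i} {i // p i} R) (v : ι → M)
    (i : {i // p i}) : ∑ j, extendByOne p X i j • v j = ∑ j, X i j • v j := by
  rw [← (Equiv.sumCompl p).sum_comp, Fintype.sum_sum_type]
  simp [extendByOne]

theorem sum_extendByOne_smul_of_neg (X : Matrix {i // p i} {i // p i} R) (v : ι → M)
    {i : ι} (hi : ¬p i) : ∑ j, extendByOne p X i j • v j = v i := by
  lift i to {i // ¬p i} using hi
  rw [← (Equiv.sumCompl p).sum_comp, Fintype.sum_sum_type]
  simp [extendByOne, one_apply, ite_smul]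

end Smul

variable [CommRing R]

theorem map_extendByOne {K : Type*} [CommRing K] (φ : R →+* K)
    (X : Matrix {i // p i} {i // p i} R) :
    (extendByOne p X).map φ = extendByOne p (X.map φ) := by
  rw [extendByOne, reindex_apply, ← submatrix_map, fromBlocks_map, extendByOne, reindex_apply,
    Matrix.map_zero φ (map_zero φ), Matrix.map_zero φ (map_zero φ),
    Matrix.map_one φ (map_zero φ) (map_one φ)]

variable [Fintype ι]

theorem det_extendByOne (X : Matrix {i // p i} {i // p i} R) :
    (extendByOne p X).det = X.det := by
  rw [extendByOne, det_reindex_self, det_fromBlocks_zero₂₁, det_one, mul_one]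

theorem exists_extendByOne_mul_eq_smul {X K : Matrix {i // p i} {i // p i} R} {f : R}
    (hXK : X * K = f • (1 : Matrix {i // p i} {i // p i} R))
    (hKX : K * X = f • (1 : Matrix {i // p i} {i // p i} R)) :
    ∃ K' : Matrix ι ι R, extendByOne p X * K' = f • (1 : Matrix ι ι R) ∧
      K' * extendByOne p X = f • (1 : Matrix ι ι R) := by
  have key : f • (1 : Matrix ι ι R) =
      (fromBlocks (f • 1) 0 0 (f • 1)).submatrix (Equiv.sumCompl p).symm
        (Equiv.sumCompl p).symm := by
    rw [← submatrix_one_equiv (Equiv.sumCompl p).symm, ← fromBlocks_one]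
    change (f • (fromBlocks 1 0 0 1 : Matrix ({i // p i} ⊕ {i // ¬p i}) _ R)).submatrix _ _ = _
    rw [fromBlocks_smul, smul_zero, smul_zero]
  refine ⟨reindex (Equiv.sumCompl p) (Equiv.sumCompl p) (fromBlocks K 0 0 (f • 1)), ?_, ?_⟩ <;>
  · rw [extendByOne, reindex_apply, reindex_apply, submatrix_mul_equiv, fromBlocks_multiply, key]
    simp [hXK, hKX]

end ExtendByOne

section LagrangianPair

open Matrix

variable {ι R : Type*} [CommRing R] [Fintype ι]

theorem exists_sqrt_det_of_mul_transpose_skew [DecidableEq ι] (h2 : IsUnit (2 : R))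
    {X Y : Matrix ι ι R} (hY : IsUnit Y.det) (h : X * Yᵀ + Y * Xᵀ = 0) :
    ∃ (f : R) (K : Matrix ι ι R), f ^ 2 = X.det * Y.det ∧ X * K = f • (1 : Matrix ι ι R) ∧
      K * X = f • (1 : Matrix ι ι R) := by
  have hskew : (X * Yᵀ)ᵀ = -(X * Yᵀ) := by
    rw [transpose_mul, transpose_transpose]
    exact eq_neg_of_add_eq_zero_right h
  obtain ⟨f, Q, hdet, h₁, h₂⟩ := exists_pfaffian h2 _ hskew
  have hY' : IsUnit (Yᵀ).det := by rwa [det_transpose]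
  refine ⟨f, Yᵀ * Q, ?_, ?_, ?_⟩
  · rw [← hdet, det_mul, det_transpose]
  · rw [← Matrix.mul_assoc, h₁]
  · calc Yᵀ * Q * X = Yᵀ * Q * X * (Yᵀ * (Yᵀ)⁻¹) := by rw [mul_nonsing_inv _ hY', Matrix.mul_one]
      _ = Yᵀ * (Q * (X * Yᵀ)) * (Yᵀ)⁻¹ := by simp only [Matrix.mul_assoc]
      _ = f • (1 : Matrix ι ι R) := by
        rw [h₂, Matrix.mul_smul, Matrix.mul_one, Matrix.smul_mul, mul_nonsing_inv _ hY']

variable {M : Type*} [AddCommGroup M] [Module R M] (β : LinearMap.BilinForm R M)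

/-- The matrix `(β (u i) (v j))` of the pairings of two families of vectors. -/
def pairingMatrix {κ κ' : Type*} (u : κ → M) (v : κ' → M) : Matrix κ κ' R :=
  of fun i j => β (u i) (v j)

theorem pairingMatrix_sum_smul_left {κ κ' : Type*} (X : Matrix κ ι R) (u : ι → M) (v : κ' → M) :
    pairingMatrix β (fun i => ∑ a, X i a • u a) v = X * pairingMatrix β u v := by
  ext i j
  simp [pairingMatrix, mul_apply, LinearMap.sum_apply]

theorem pairingMatrix_sum_smul_right {κ κ' : Type*} (X : Matrix κ ι R) (u : κ' → M) (v : ι → M) :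
    pairingMatrix β u (fun i => ∑ a, X i a • v a) = pairingMatrix β u v * Xᵀ := by
  ext i j
  simp [pairingMatrix, mul_apply, mul_comm]

variable {β}

theorem transpose_pairingMatrix (hβ : ∀ x y, β x y = β y x) {κ κ' : Type*}
    (u : κ → M) (v : κ' → M) : (pairingMatrix β u v)ᵀ = pairingMatrix β v u := by
  ext i j
  exact hβ _ _

variable {L₁ L₂ : Submodule R M} {u v w : ι → M} {X : Matrix ι ι R}

theorem pairingMatrix_mul_transpose_add (hβ : ∀ x y, β x y = β y x)
    (h₁ : ∀ x ∈ L₁, ∀ y ∈ L₁, β x y = 0) (h₂ : ∀ x ∈ L₂, ∀ y ∈ L₂, β x y = 0)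
    (hu : ∀ i, u i ∈ L₁) (huv : ∀ i, u i - ∑ a, X i a • v a ∈ L₂) :
    pairingMatrix β u v * Xᵀ + X * (pairingMatrix β u v)ᵀ = X * pairingMatrix β v v * Xᵀ := by
  rw [transpose_pairingMatrix hβ, ← pairingMatrix_sum_smul_left, ← pairingMatrix_sum_smul_right,
    ← pairingMatrix_sum_smul_left, ← pairingMatrix_sum_smul_right]
  ext i j
  have h := h₂ _ (huv i) _ (huv j)
  rw [map_sub, map_sub, LinearMap.sub_apply, LinearMap.sub_apply, h₁ _ (hu i) _ (hu j)] at h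
  simp only [pairingMatrix, Matrix.add_apply, of_apply]
  linear_combination -h

theorem exists_pairingMatrix_mul_add_mul_eq_one [DecidableEq ι]
    (h₁ : ∀ x ∈ L₁, ∀ y ∈ L₁, β x y = 0) (h₂ : ∀ x ∈ L₂, ∀ y ∈ L₂, β x y = 0)
    (hu : ∀ i, u i ∈ L₁) (huv : ∀ i, u i - ∑ a, X i a • v a ∈ L₂)
    (hw : pairingMatrix β u w = 1) (hsup : L₁ ⊔ Submodule.span R (Set.range v) ⊔ L₂ = ⊤) :
    ∃ b c : Matrix ι ι R, pairingMatrix β u v * b + X * c = 1 := by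
  have hdecomp : ∀ j, ∃ b : ι → R, ∃ r ∈ L₂, w j - (∑ a, b a • v a) - r ∈ L₁ := fun j => by
    have hj : w j ∈ L₁ ⊔ Submodule.span R (Set.range v) ⊔ L₂ := hsup ▸ trivial
    obtain ⟨y, hy, r, hr, hyr⟩ := Submodule.mem_sup.1 hj
    obtain ⟨l, hl, s, hs, rfl⟩ := Submodule.mem_sup.1 hy
    obtain ⟨b, rfl⟩ := (Submodule.mem_span_range_iff_exists_fun R).1 hs
    exact ⟨b, r, hr, by rwa [← hyr, sub_right_comm, add_sub_cancel_right, add_sub_cancel_right]⟩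
  choose b r hr hl using hdecomp
  refine ⟨(of b)ᵀ, pairingMatrix β v r, ?_⟩
  rw [← pairingMatrix_sum_smul_right, ← pairingMatrix_sum_smul_left, ← hw]
  ext i j
  have hl' := h₁ _ (hu i) _ (hl j)
  have hr' := h₂ _ (huv i) _ (hr j)
  rw [map_sub, map_sub] at hl'
  rw [map_sub, LinearMap.sub_apply] at hr'
  simp only [pairingMatrix, Matrix.add_apply, of_apply]
  linear_combination -hl' - hr'

theorem exists_mul_transpose_skew [DecidableEq ι] (hβ : ∀ x y, β x y = β y x)
    (h2 : IsUnit (2 : R)) (h₁ : ∀ x ∈ L₁, ∀ y ∈ L₁, β x y = 0) (h₂ : ∀ x ∈ L₂, ∀ y ∈ L₂, β x y = 0)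
    (hu : ∀ i, u i ∈ L₁) (huv : ∀ i, u i - ∑ a, X i a • v a ∈ L₂)
    (hw : pairingMatrix β u w = 1) (hsup : L₁ ⊔ Submodule.span R (Set.range v) ⊔ L₂ = ⊤)
    {K : Type*} [CommRing K] {φ : R →+* K} (hX : φ.mapMatrix X = 0) :
    ∃ Y : Matrix ι ι R, X * Yᵀ + Y * Xᵀ = 0 ∧ IsUnit (φ Y.det) := by
  obtain ⟨c, hc⟩ := h2.exists_left_inv
  set H := pairingMatrix β u v
  set G := pairingMatrix β v v
  have hHG : H * Xᵀ + X * Hᵀ = X * G * Xᵀ := pairingMatrix_mul_transpose_add hβ h₁ h₂ hu huv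
  have hG : Gᵀ = G := transpose_pairingMatrix hβ v v
  refine ⟨H - c • (X * G), ?_, ?_⟩
  · calc X * (H - c • (X * G))ᵀ + (H - c • (X * G)) * Xᵀ
        = (H * Xᵀ + X * Hᵀ) - (c * 2) • (X * G * Xᵀ) := by
          rw [transpose_sub, transpose_smul, transpose_mul, hG, Matrix.mul_sub, Matrix.sub_mul,
            Matrix.mul_smul, Matrix.smul_mul, mul_two, add_smul, Matrix.mul_assoc]
          abel
      _ = 0 := by rw [hHG, hc, one_smul, sub_self]
  · obtain ⟨b, d, hbd⟩ := exists_pairingMatrix_mul_add_mul_eq_one h₁ h₂ hu huv hw hsup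
    have hY : φ.mapMatrix (H - c • (X * G)) = φ.mapMatrix H := by
      rw [map_sub, ← Algebra.smul_mul_assoc, ← smul_one_mul c X, map_mul, map_mul, hX, mul_zero,
        zero_mul, sub_zero]
    have hHb : φ.mapMatrix H * φ.mapMatrix b = 1 := by
      rw [← map_one φ.mapMatrix, ← hbd, map_add, map_mul, map_mul, hX, zero_mul, add_zero]
    rw [RingHom.map_det, hY]
    exact (isUnit_iff_isUnit_det _).1 (IsUnit.of_mul_eq_one _ hHb)

end LagrangianPair

section IdempotentCorner

variable {A : Type*} [Ring A] {e s t : A}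

theorem one_add_mul_one_sub_cancel (he : e * e = e) (a : A) :
    (1 + e * a * (1 - e)) * (1 - e * a * (1 - e)) = 1 := by
  have h : (1 - e) * e = 0 := by rw [sub_mul, one_mul, he, sub_self]
  calc (1 + e * a * (1 - e)) * (1 - e * a * (1 - e))
      = 1 - e * a * ((1 - e) * e) * a * (1 - e) := by noncomm_ring
    _ = 1 := by rw [h, mul_zero, zero_mul, zero_mul, sub_zero]

theorem one_sub_mul_one_add_cancel (he : e * e = e) (a : A) :
    (1 - e * a * (1 - e)) * (1 + e * a * (1 - e)) = 1 := by
  have h := one_add_mul_one_sub_cancel he (-a)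
  rwa [mul_neg, neg_mul, sub_neg_eq_add, ← sub_eq_add_neg] at h

theorem one_add_mul_sub_mul_mul (he : e * e = e) (hts : t * s = 1) :
    (1 + e * s * (1 - e)) * ((t - e) * s) = 1 - e * s * e := by
  have h : (1 - e) * e = 0 := by rw [sub_mul, one_mul, he, sub_self]
  calc (1 + e * s * (1 - e)) * ((t - e) * s)
      = 1 - e * s * e - e * s * ((1 - e) * e) * s := by rw [sub_mul, hts]; noncomm_ring
    _ = 1 - e * s * e := by rw [h, mul_zero, zero_mul, sub_zero]

end IdempotentCorner

namespace SuperGrading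

variable {R : Type u} [Ring R] (σ : SuperGrading R)

/-- The homogeneous component of a parity: `false` is even, `true` is odd. -/
def homog : Bool → AddSubgroup R
  | false => σ.even.toAddSubgroup
  | true => σ.odd

theorem mul_mem_homog {p q : Bool} {a b : R} (ha : a ∈ σ.homog p) (hb : b ∈ σ.homog q) :
    a * b ∈ σ.homog (p ^^ q) := by
  cases p <;> cases q
  · exact σ.even.mul_mem ha hb
  · exact σ.even_mul_odd a ha b hb
  · exact σ.even_comm b hb a ▸ σ.even_mul_odd b hb a ha
  · exact σ.odd_mul_odd a ha b hb

theorem eq_zero_of_mem_even_of_mem_odd {a : R} (h₀ : a ∈ σ.even) (h₁ : a ∈ σ.odd) : a = 0 :=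
  AddSubgroup.disjoint_def.1 σ.isCompl.disjoint h₀ h₁

theorem sub_evenPart_mem_odd (a : R) : a - σ.evenPart a ∈ σ.odd :=
  (σ.exists_evenPart a).choose_spec

theorem evenPart_eq {a : R} {b : σ.even} (h : a - b ∈ σ.odd) : σ.evenPart a = b := by
  have hodd := sub_mem h (σ.sub_evenPart_mem_odd a)
  rw [sub_sub_sub_cancel_left] at hodd
  exact Subtype.ext (sub_eq_zero.1
    (σ.eq_zero_of_mem_even_of_mem_odd (sub_mem (σ.evenPart a).2 b.2) hodd))

@[simp] theorem evenPart_coe (a : σ.even) : σ.evenPart (a : R) = a :=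
  σ.evenPart_eq (by simp [zero_mem])

theorem exists_homog_add (p : Bool) (a : R) :
    ∃ b ∈ σ.homog p, ∃ c ∈ σ.homog (!p), a = b + c := by
  cases p
  · exact ⟨_, (σ.evenPart a).2, _, σ.sub_evenPart_mem_odd a, by simp⟩
  · exact ⟨_, σ.sub_evenPart_mem_odd a, _, (σ.evenPart a).2, by simp⟩

theorem odd_mul_self (h2 : IsUnit (2 : σ.even)) {a : R} (ha : a ∈ σ.odd) : a * a = 0 := by
  have h : (2 : R) * (a * a) = 0 := by
    rw [two_mul]
    exact eq_neg_iff_add_eq_zero.1 (σ.odd_anticomm a ha a ha)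
  exact (h2.map σ.even.subtype).mul_right_eq_zero.1 h

theorem odd_mul_odd_mul_self (h2 : IsUnit (2 : σ.even)) {a b : R} (ha : a ∈ σ.odd)
    (hb : b ∈ σ.odd) : a * b * (a * b) = 0 :=
  calc a * b * (a * b) = a * (b * a) * b := by simp only [mul_assoc]
    _ = -(a * a * (b * b)) := by
      rw [σ.odd_anticomm b hb a ha, mul_neg, neg_mul, ← mul_assoc, mul_assoc (a * a)]
    _ = 0 := by rw [σ.odd_mul_self h2 ha, zero_mul, neg_zero]

theorem isNilpotent_odd_mul_odd (h2 : IsUnit (2 : σ.even)) {a b : R} (ha : a ∈ σ.odd)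
    (hb : b ∈ σ.odd) : IsNilpotent (⟨a * b, σ.odd_mul_odd a ha b hb⟩ : σ.even) :=
  ⟨2, (pow_two _).trans (Subtype.ext (σ.odd_mul_odd_mul_self h2 ha hb))⟩

open Matrix

/-- All entries of the matrix are odd. -/
def IsOddMatrix {ι κ : Type*} (B : Matrix ι κ R) : Prop := ∀ i j, B i j ∈ σ.odd

section OddMatrix

variable {σ} {ι κ : Type*}

theorem isOddMatrix_zero : σ.IsOddMatrix (0 : Matrix ι κ R) := fun _ _ => zero_mem _

theorem isOddMatrix_single [DecidableEq ι] [DecidableEq κ] (i : ι) (j : κ) {b : R}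
    (hb : b ∈ σ.odd) : σ.IsOddMatrix (single i j b) := fun k l => by
  rw [single_apply]
  split_ifs
  exacts [hb, zero_mem _]

namespace IsOddMatrix

variable {B B' : Matrix ι κ R}

theorem neg (hB : σ.IsOddMatrix B) : σ.IsOddMatrix (-B) :=
  fun i j => neg_mem (hB i j)

theorem add (hB : σ.IsOddMatrix B) (hB' : σ.IsOddMatrix B') : σ.IsOddMatrix (B + B') :=
  fun i j => add_mem (hB i j) (hB' i j)

end IsOddMatrix

end OddMatrix

section CoeMatrix

variable {ι κ : Type*} [Fintype ι] [DecidableEq ι]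

/-- A matrix of even elements as a matrix over the whole ring. -/
def coeMatrix : Matrix ι ι σ.even →+* Matrix ι ι R := σ.even.subtype.mapMatrix

@[simp] theorem coeMatrix_apply (A : Matrix ι ι σ.even) (i j : ι) : σ.coeMatrix A i j = A i j :=
  rfl

variable {σ} {B : Matrix ι κ R} {C : Matrix κ ι R}

theorem exists_coeMatrix_eq {M : Matrix ι ι R} (h : ∀ i j, M i j ∈ σ.even) :
    ∃ T, σ.coeMatrix T = M :=
  ⟨of fun i j => ⟨M i j, h i j⟩, rfl⟩

theorem coeMatrix_inv_mul {D : Matrix ι ι σ.even} (hD : IsUnit D.det) :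
    σ.coeMatrix D⁻¹ * σ.coeMatrix D = 1 := by
  rw [← map_mul, nonsing_inv_mul _ hD, map_one]

theorem coeMatrix_mul_inv {D : Matrix ι ι σ.even} (hD : IsUnit D.det) :
    σ.coeMatrix D * σ.coeMatrix D⁻¹ = 1 := by
  rw [← map_mul, mul_nonsing_inv _ hD, map_one]

theorem IsOddMatrix.coeMatrix_mul (hB : σ.IsOddMatrix B) (A : Matrix ι ι σ.even) :
    σ.IsOddMatrix (σ.coeMatrix A * B) := fun i j => by
  rw [mul_apply]
  exact sum_mem fun k _ => σ.even_mul_odd _ (A i k).2 _ (hB k j)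

theorem IsOddMatrix.mul_coeMatrix (hC : σ.IsOddMatrix C) (D : Matrix ι ι σ.even) :
    σ.IsOddMatrix (C * σ.coeMatrix D) := fun i j => by
  rw [mul_apply]
  refine sum_mem fun k _ => ?_
  rw [σ.coeMatrix_apply, ← σ.even_comm _ (D k j).2]
  exact σ.even_mul_odd _ (D k j).2 _ (hC i k)

variable [Fintype κ]

theorem IsOddMatrix.exists_coeMatrix_eq_mul (hB : σ.IsOddMatrix B) (hC : σ.IsOddMatrix C) :
    ∃ T, σ.coeMatrix T = B * C :=
  exists_coeMatrix_eq fun i j => by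
    rw [mul_apply]
    exact sum_mem fun k _ => σ.odd_mul_odd _ (hB i k) _ (hC k j)

theorem sub_mem_nilradical_of_coeMatrix_eq_add (h2 : IsUnit (2 : σ.even)) (hB : σ.IsOddMatrix B)
    (hC : σ.IsOddMatrix C) {A T : Matrix ι ι σ.even}
    (h : σ.coeMatrix T = σ.coeMatrix A + B * C) (i j : ι) :
    T i j - A i j ∈ nilradical σ.even := by
  have hsum : T i j - A i j = ∑ k, ⟨B i k * C k j, σ.odd_mul_odd _ (hB i k) _ (hC k j)⟩ := by
    have hij : (T i j : R) = A i j + ∑ k, B i k * C k j := congrFun (congrFun h i) j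
    apply Subtype.ext
    push_cast
    rw [hij, add_sub_cancel_left]
  rw [hsum]
  exact sum_mem fun k _ => σ.isNilpotent_odd_mul_odd h2 (hB i k) (hC k j)

theorem isUnit_det_of_coeMatrix_eq_add (h2 : IsUnit (2 : σ.even)) (hB : σ.IsOddMatrix B)
    (hC : σ.IsOddMatrix C) {A T : Matrix ι ι σ.even}
    (h : σ.coeMatrix T = σ.coeMatrix A + B * C) (hA : IsUnit A.det) : IsUnit T.det := by
  have hdet : T.det - A.det ∈ nilradical σ.even := by
    rw [← Ideal.Quotient.eq, RingHom.map_det, RingHom.map_det]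
    exact congrArg det (Matrix.ext fun i j => (Ideal.Quotient.eq).2
      (sub_mem_nilradical_of_coeMatrix_eq_add h2 hB hC h i j))
  simpa using (mem_nilradical.1 hdet).isUnit_add_right_of_commute hA (Commute.all _ _)

variable [DecidableEq κ]

theorem IsOddMatrix.exists_coeMatrix_eq_schur (hB : σ.IsOddMatrix B) (hC : σ.IsOddMatrix C)
    (A : Matrix ι ι σ.even) (D : Matrix κ κ σ.even) :
    ∃ T, σ.coeMatrix T = σ.coeMatrix A - B * σ.coeMatrix D * C := by
  obtain ⟨T, hT⟩ := (hB.mul_coeMatrix D).exists_coeMatrix_eq_mul hC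
  exact ⟨A - T, by rw [map_sub, hT]⟩

theorem isUnit_det_schur (h2 : IsUnit (2 : σ.even)) (hB : σ.IsOddMatrix B) (hC : σ.IsOddMatrix C)
    {A T : Matrix ι ι σ.even} {D : Matrix κ κ σ.even}
    (hT : σ.coeMatrix T = σ.coeMatrix A - B * σ.coeMatrix D * C) (hA : IsUnit A.det) :
    IsUnit T.det :=
  isUnit_det_of_coeMatrix_eq_add h2 (hB.mul_coeMatrix D) hC.neg
    (by rw [hT, Matrix.mul_neg, sub_eq_add_neg]) hA

end CoeMatrix

section EvenMatrix

variable {m n : ℕ}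

/-- The supermatrix defines an even map: its entries have the parity prescribed by their
position. -/
def IsEvenMatrix (N : Matrix (Fin m ⊕ Fin n) (Fin m ⊕ Fin n) R) : Prop :=
  ∀ i j, N i j ∈ σ.homog (i.isRight ^^ j.isRight)

/-- The supermatrix defines an even invertible map. -/
def IsEvenUnit (N : Matrix (Fin m ⊕ Fin n) (Fin m ⊕ Fin n) R) : Prop :=
  σ.IsEvenMatrix N ∧ ∃ N', σ.IsEvenMatrix N' ∧ N * N' = 1 ∧ N' * N = 1

variable {σ} {M N : Matrix (Fin m ⊕ Fin n) (Fin m ⊕ Fin n) R}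
  {A T : Matrix (Fin m) (Fin m) σ.even} {B : Matrix (Fin m) (Fin n) R}
  {C : Matrix (Fin n) (Fin m) R} {D : Matrix (Fin n) (Fin n) σ.even}

theorem isEvenMatrix_fromBlocks (hB : σ.IsOddMatrix B) (hC : σ.IsOddMatrix C) :
    σ.IsEvenMatrix (fromBlocks (σ.coeMatrix A) B C (σ.coeMatrix D)) := by
  rintro (i | i) (j | j)
  exacts [(A i j).2, hB i j, hC i j, (D i j).2]

theorem IsEvenMatrix.exists_fromBlocks (hN : σ.IsEvenMatrix N) :
    ∃ A B C D, σ.IsOddMatrix B ∧ σ.IsOddMatrix C ∧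
      N = fromBlocks (σ.coeMatrix A) B C (σ.coeMatrix D) := by
  obtain ⟨A, hA⟩ := exists_coeMatrix_eq (σ := σ) (M := N.toBlocks₁₁) fun i j => hN (.inl i) (.inl j)
  obtain ⟨D, hD⟩ := exists_coeMatrix_eq (σ := σ) (M := N.toBlocks₂₂) fun i j => hN (.inr i) (.inr j)
  exact ⟨A, N.toBlocks₁₂, N.toBlocks₂₁, D, fun i j => hN (.inl i) (.inr j),
    fun i j => hN (.inr i) (.inl j), by rw [hA, hD, fromBlocks_toBlocks]⟩

theorem IsEvenMatrix.mul (hM : σ.IsEvenMatrix M) (hN : σ.IsEvenMatrix N) :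
    σ.IsEvenMatrix (M * N) := fun i j => by
  rw [mul_apply]
  refine sum_mem fun k _ => ?_
  have h := σ.mul_mem_homog (hM i k) (hN k j)
  rwa [Bool.xor_assoc, ← Bool.xor_assoc k.isRight, Bool.xor_self, Bool.false_xor] at h

theorem IsEvenUnit.mul (hM : σ.IsEvenUnit M) (hN : σ.IsEvenUnit N) : σ.IsEvenUnit (M * N) := by
  obtain ⟨hM, M', hM', hMM', hM'M⟩ := hM
  obtain ⟨hN, N', hN', hNN', hN'N⟩ := hN
  refine ⟨hM.mul hN, N' * M', hN'.mul hM', ?_, ?_⟩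
  · rw [Matrix.mul_assoc, ← Matrix.mul_assoc N, hNN', Matrix.one_mul, hMM']
  · rw [Matrix.mul_assoc, ← Matrix.mul_assoc M', hM'M, Matrix.one_mul, hN'N]

theorem isEvenUnit_upper (hB : σ.IsOddMatrix B) : σ.IsEvenUnit (fromBlocks 1 B 0 1) := by
  rw [← map_one σ.coeMatrix, ← map_one σ.coeMatrix]
  refine ⟨isEvenMatrix_fromBlocks hB isOddMatrix_zero, _,
    isEvenMatrix_fromBlocks (A := 1) (D := 1) hB.neg isOddMatrix_zero, ?_, ?_⟩ <;>
  simp [fromBlocks_multiply]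

theorem isEvenUnit_lower (hC : σ.IsOddMatrix C) : σ.IsEvenUnit (fromBlocks 1 0 C 1) := by
  rw [← map_one σ.coeMatrix, ← map_one σ.coeMatrix]
  refine ⟨isEvenMatrix_fromBlocks isOddMatrix_zero hC, _,
    isEvenMatrix_fromBlocks (A := 1) (D := 1) isOddMatrix_zero hC.neg, ?_, ?_⟩ <;>
  simp [fromBlocks_multiply]

theorem isEvenUnit_diag (hA : IsUnit A.det) (hD : IsUnit D.det) :
    σ.IsEvenUnit (fromBlocks (σ.coeMatrix A) 0 0 (σ.coeMatrix D)) := by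
  refine ⟨isEvenMatrix_fromBlocks isOddMatrix_zero isOddMatrix_zero, _,
    isEvenMatrix_fromBlocks (A := A⁻¹) (D := D⁻¹) isOddMatrix_zero isOddMatrix_zero, ?_, ?_⟩ <;>
  simp [fromBlocks_multiply, coeMatrix_inv_mul, coeMatrix_mul_inv, hA, hD]

theorem IsEvenUnit.isUnit_det (h2 : IsUnit (2 : σ.even)) (hB : σ.IsOddMatrix B)
    (hC : σ.IsOddMatrix C)
    (h : σ.IsEvenUnit (fromBlocks (σ.coeMatrix A) B C (σ.coeMatrix D))) :
    IsUnit A.det ∧ IsUnit D.det := by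
  obtain ⟨-, N', hN', hNN', -⟩ := h
  obtain ⟨A', B', C', D', hB', hC', rfl⟩ := hN'.exists_fromBlocks
  rw [fromBlocks_multiply, ← fromBlocks_one, fromBlocks_inj] at hNN'
  obtain ⟨hAA', -, -, hDD'⟩ := hNN'
  have hA : IsUnit (A * A').det :=
    isUnit_det_of_coeMatrix_eq_add h2 hB hC'.neg (A := 1)
      (by rw [map_one, ← hAA', map_mul, Matrix.mul_neg, add_neg_cancel_right]) (by simp)
  have hD : IsUnit (D * D').det :=
    isUnit_det_of_coeMatrix_eq_add h2 hC hB'.neg (A := 1)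
      (by rw [map_one, ← hDD', map_mul, Matrix.mul_neg, add_neg_cancel_comm]) (by simp)
  rw [det_mul] at hA hD
  exact ⟨isUnit_of_mul_isUnit_left hA, isUnit_of_mul_isUnit_left hD⟩

theorem fromBlocks_eq_upper_mul_diag_mul_lower (hD : IsUnit D.det)
    (hT : σ.coeMatrix T = σ.coeMatrix A - B * σ.coeMatrix D⁻¹ * C) :
    fromBlocks (σ.coeMatrix A) B C (σ.coeMatrix D) = fromBlocks 1 (B * σ.coeMatrix D⁻¹) 0 1 *
      fromBlocks (σ.coeMatrix T) 0 0 (σ.coeMatrix D) *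
        fromBlocks 1 0 (σ.coeMatrix D⁻¹ * C) 1 := by
  simp only [fromBlocks_multiply, Matrix.one_mul, Matrix.mul_one, Matrix.zero_mul, Matrix.mul_zero,
    add_zero, zero_add]
  rw [Matrix.mul_assoc B, coeMatrix_inv_mul hD, Matrix.mul_one, ← Matrix.mul_assoc (σ.coeMatrix D),
    coeMatrix_mul_inv hD, Matrix.one_mul, hT, ← Matrix.mul_assoc B, sub_add_cancel]

theorem isEvenUnit_fromBlocks (h2 : IsUnit (2 : σ.even)) (hB : σ.IsOddMatrix B)
    (hC : σ.IsOddMatrix C) (hA : IsUnit A.det) (hD : IsUnit D.det) :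
    σ.IsEvenUnit (fromBlocks (σ.coeMatrix A) B C (σ.coeMatrix D)) := by
  obtain ⟨T, hT⟩ := hB.exists_coeMatrix_eq_schur hC A D⁻¹
  rw [fromBlocks_eq_upper_mul_diag_mul_lower hD hT]
  exact ((isEvenUnit_upper (hB.mul_coeMatrix _)).mul
    (isEvenUnit_diag (isUnit_det_schur h2 hB hC hT hA) hD)).mul
      (isEvenUnit_lower (hC.coeMatrix_mul _))

theorem IsEvenUnit.exists_decomposition (h2 : IsUnit (2 : σ.even)) (hN : σ.IsEvenUnit N) :
    ∃ (A : Matrix (Fin m) (Fin m) σ.even) (B : Matrix (Fin m) (Fin n) R)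
      (C : Matrix (Fin n) (Fin m) R) (D : Matrix (Fin n) (Fin n) σ.even),
      IsUnit A.det ∧ σ.IsOddMatrix B ∧ σ.IsOddMatrix C ∧ IsUnit D.det ∧
      N = fromBlocks 1 B 0 1 * fromBlocks (σ.coeMatrix A) 0 0 (σ.coeMatrix D) *
        fromBlocks 1 0 C 1 := by
  obtain ⟨A, B, C, D, hB, hC, rfl⟩ := hN.1.exists_fromBlocks
  obtain ⟨hA, hD⟩ := hN.isUnit_det h2 hB hC
  obtain ⟨T, hT⟩ := hB.exists_coeMatrix_eq_schur hC A D⁻¹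
  exact ⟨T, _, _, D, isUnit_det_schur h2 hB hC hT hA, hB.mul_coeMatrix D⁻¹, hC.coeMatrix_mul D⁻¹,
    hD, fromBlocks_eq_upper_mul_diag_mul_lower hD hT⟩

end EvenMatrix

section Berezinian

variable {σ} {m n : ℕ} {M N : Matrix (Fin m ⊕ Fin n) (Fin m ⊕ Fin n) R}
  {A T : Matrix (Fin m) (Fin m) σ.even} {B : Matrix (Fin m) (Fin n) R}
  {C : Matrix (Fin n) (Fin m) R} {D : Matrix (Fin n) (Fin n) σ.even}

theorem ber_fromBlocks (hT : σ.coeMatrix T = σ.coeMatrix A - B * σ.coeMatrix D⁻¹ * C) :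
    σ.ber (fromBlocks (σ.coeMatrix A) B C (σ.coeMatrix D)) = T.det * Ring.inverse D.det := by
  have hD : (of fun k l => σ.evenPart
      (fromBlocks (σ.coeMatrix A) B C (σ.coeMatrix D) (.inr k) (.inr l))) = D := by
    ext k l
    simp
  have hTij : ∀ i j, (T i j : R) = A i j - ∑ k, ∑ l, B i k * (D⁻¹ k l : σ.even) * C l j := by
    intro i j
    have h := congrFun (congrFun hT i) j
    simp only [coeMatrix_apply, Matrix.sub_apply, mul_apply, Finset.sum_mul] at h
    rw [h, Finset.sum_comm]
  unfold ber
  rw [hD]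
  dsimp only
  congr 2
  refine Matrix.ext fun i j => ?_
  rw [of_apply, ← σ.evenPart_coe (T i j), hTij]
  rfl

theorem ber_diag :
    σ.ber (fromBlocks (σ.coeMatrix A) 0 0 (σ.coeMatrix D)) = A.det * Ring.inverse D.det :=
  ber_fromBlocks (by simp)

theorem ber_one : σ.ber (1 : Matrix (Fin m ⊕ Fin n) (Fin m ⊕ Fin n) R) = 1 := by
  rw [← fromBlocks_one, ← map_one σ.coeMatrix, ← map_one σ.coeMatrix, ber_diag]
  simp

theorem ber_upper_mul (hB : σ.IsOddMatrix B) (h2 : IsUnit (2 : σ.even)) (hM : σ.IsEvenUnit M) :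
    σ.ber (fromBlocks 1 B 0 1 * M) = σ.ber M := by
  obtain ⟨A, B', C, D, hB', hC, rfl⟩ := hM.1.exists_fromBlocks
  obtain ⟨-, hD⟩ := hM.isUnit_det h2 hB' hC
  obtain ⟨T, hT⟩ := hB'.exists_coeMatrix_eq_schur hC A D⁻¹
  obtain ⟨P, hP⟩ := hB.exists_coeMatrix_eq_mul hC
  rw [ber_fromBlocks hT, fromBlocks_multiply]
  simp only [Matrix.one_mul, Matrix.zero_mul, zero_add]
  rw [← hP, ← map_add]
  refine ber_fromBlocks ?_
  rw [hT, map_add, hP, Matrix.add_mul, Matrix.mul_assoc B, coeMatrix_mul_inv hD, Matrix.add_mul,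
    Matrix.mul_one]
  abel

theorem ber_mul_lower (hC : σ.IsOddMatrix C) (h2 : IsUnit (2 : σ.even)) (hM : σ.IsEvenUnit M) :
    σ.ber (M * fromBlocks 1 0 C 1) = σ.ber M := by
  obtain ⟨A, B, C', D, hB, hC', rfl⟩ := hM.1.exists_fromBlocks
  obtain ⟨-, hD⟩ := hM.isUnit_det h2 hB hC'
  obtain ⟨T, hT⟩ := hB.exists_coeMatrix_eq_schur hC' A D⁻¹
  obtain ⟨P, hP⟩ := hB.exists_coeMatrix_eq_mul hC
  rw [ber_fromBlocks hT, fromBlocks_multiply]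
  simp only [Matrix.mul_one, Matrix.mul_zero, zero_add]
  rw [← hP, ← map_add]
  refine ber_fromBlocks ?_
  rw [hT, map_add, hP, Matrix.mul_add, Matrix.mul_assoc B, Matrix.mul_assoc B,
    ← Matrix.mul_assoc (σ.coeMatrix D⁻¹) (σ.coeMatrix D), coeMatrix_inv_mul hD, Matrix.one_mul]
  abel

theorem ber_diag_mul (hD : IsUnit D.det) (hM : σ.IsEvenUnit M) :
    σ.ber (fromBlocks (σ.coeMatrix A) 0 0 (σ.coeMatrix D) * M) =
      A.det * Ring.inverse D.det * σ.ber M := by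
  obtain ⟨A', B, C, D', hB, hC, rfl⟩ := hM.1.exists_fromBlocks
  obtain ⟨T, hT⟩ := hB.exists_coeMatrix_eq_schur hC A' D'⁻¹
  rw [ber_fromBlocks hT, fromBlocks_multiply]
  simp only [Matrix.zero_mul, zero_add, add_zero]
  rw [← map_mul, ← map_mul, ber_fromBlocks (T := A * T), det_mul, det_mul, Ring.mul_inverse_rev]
  · ring
  · rw [map_mul, hT, map_mul, Matrix.mul_inv_rev, map_mul, Matrix.mul_sub,
      Matrix.mul_assoc (σ.coeMatrix A) B, Matrix.mul_assoc (σ.coeMatrix A), ← Matrix.mul_assoc B,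
      Matrix.mul_assoc (B * σ.coeMatrix D'⁻¹), ← Matrix.mul_assoc (σ.coeMatrix D⁻¹),
      coeMatrix_inv_mul hD, Matrix.one_mul]

theorem ber_mul_diag (hD : IsUnit D.det) (hM : σ.IsEvenUnit M) :
    σ.ber (M * fromBlocks (σ.coeMatrix A) 0 0 (σ.coeMatrix D)) =
      σ.ber M * (A.det * Ring.inverse D.det) := by
  obtain ⟨A', B, C, D', hB, hC, rfl⟩ := hM.1.exists_fromBlocks
  obtain ⟨T, hT⟩ := hB.exists_coeMatrix_eq_schur hC A' D'⁻¹
  rw [ber_fromBlocks hT, fromBlocks_multiply]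
  simp only [Matrix.mul_zero, zero_add, add_zero]
  rw [← map_mul, ← map_mul, ber_fromBlocks (T := T * A), det_mul, det_mul, Ring.mul_inverse_rev]
  · ring
  · rw [map_mul, hT, map_mul, Matrix.mul_inv_rev, map_mul, Matrix.sub_mul,
      ← Matrix.mul_assoc (B * σ.coeMatrix D), Matrix.mul_assoc B (σ.coeMatrix D),
      coeMatrix_mul_inv hD, Matrix.mul_one, ← Matrix.mul_assoc]

theorem ber_lower_mul_upper {P : Matrix (Fin n) (Fin n) σ.even} {Q : Matrix (Fin m) (Fin m) σ.even}
    (hP : σ.coeMatrix P = C * B) (hQ : σ.coeMatrix Q = B * C)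
    (hdet : (1 + Q).det * (1 + P).det = 1) :
    σ.ber (fromBlocks 1 0 C 1 * fromBlocks 1 B 0 1) = 1 := by
  have hPu : IsUnit (1 + P).det := .of_mul_eq_one_right _ hdet
  have hQu : IsUnit (1 + Q).det := .of_mul_eq_one _ hdet
  have hP1 : σ.coeMatrix (1 + P) = 1 + C * B := by rw [map_add, map_one, hP]
  have hQ1 : σ.coeMatrix (1 + Q) = 1 + B * C := by rw [map_add, map_one, hQ]
  have hcomm : C * σ.coeMatrix (1 + Q) = σ.coeMatrix (1 + P) * C := by
    rw [hP1, hQ1, Matrix.mul_add, Matrix.add_mul, Matrix.mul_one, Matrix.one_mul, Matrix.mul_assoc]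
  have hinv : (1 - B * σ.coeMatrix (1 + P)⁻¹ * C) * σ.coeMatrix (1 + Q) = 1 := by
    rw [Matrix.sub_mul, Matrix.mul_assoc (B * _), hcomm, Matrix.mul_assoc B,
      ← Matrix.mul_assoc (σ.coeMatrix (1 + P)⁻¹), coeMatrix_inv_mul hPu, Matrix.one_mul,
      Matrix.one_mul, hQ1, add_sub_cancel_right]
  have hschur : σ.coeMatrix (1 + Q)⁻¹ = 1 - B * σ.coeMatrix (1 + P)⁻¹ * C := by
    calc
      _ = (1 - B * σ.coeMatrix (1 + P)⁻¹ * C) * σ.coeMatrix (1 + Q) * σ.coeMatrix (1 + Q)⁻¹ := by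
        rw [hinv, Matrix.one_mul]
      _ = _ := by rw [Matrix.mul_assoc, coeMatrix_mul_inv hQu, Matrix.mul_one]
  have hprod : fromBlocks 1 0 C 1 * fromBlocks 1 B 0 1 =
      fromBlocks (σ.coeMatrix 1) B C (σ.coeMatrix (1 + P)) := by
    simp only [fromBlocks_multiply, Matrix.mul_one, Matrix.one_mul, Matrix.mul_zero, add_zero,
      add_comm (C * B), hP1, map_one]
  rw [hprod, ber_fromBlocks (T := (1 + Q)⁻¹) (by rw [hschur, map_one]), det_nonsing_inv,
    ← Ring.mul_inverse_rev, mul_comm, hdet, Ring.inverse_one]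

/-- With `c = C_ji b`, the determinants of `1 + C E` and `1 + E C` are `1 + c` and `1 - c`, and
`c ^ 2 = 0`. -/
theorem ber_lower_mul_upper_single (h2 : IsUnit (2 : σ.even)) (hC : σ.IsOddMatrix C) (i : Fin m)
    (j : Fin n) {b : R} (hb : b ∈ σ.odd) :
    σ.ber (fromBlocks 1 0 C 1 * fromBlocks 1 (single i j b) 0 1) = 1 := by
  have hE := isOddMatrix_single (σ := σ) i j hb
  obtain ⟨P, hP⟩ := hC.exists_coeMatrix_eq_mul hE
  obtain ⟨Q, hQ⟩ := hE.exists_coeMatrix_eq_mul hC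
  let c : σ.even := ⟨C j i * b, σ.odd_mul_odd _ (hC j i) _ hb⟩
  have hc : c * c = 0 := Subtype.ext (σ.odd_mul_odd_mul_self h2 (hC j i) hb)
  have hPkl : ∀ k l, (P k l : R) = (C * single i j b) k l := fun k l => congrFun (congrFun hP k) l
  have hQkl : ∀ k l, (Q k l : R) = (single i j b * C) k l := fun k l => congrFun (congrFun hQ k) l
  have hdetP : (1 + P).det = 1 + c := by
    have hPjj : P j j = c := Subtype.ext (by rw [hPkl, mul_single_apply_same])
    rw [det_one_add_of_col_eq_zero (j := j), hPjj]
    exact fun k l hl => Subtype.ext (by rw [hPkl, mul_single_apply_of_ne _ _ _ _ _ hl]; rfl)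
  have hdetQ : (1 + Q).det = 1 - c := by
    have hQii : Q i i = -c := Subtype.ext
      (by rw [hQkl, single_mul_apply_same, σ.odd_anticomm b hb _ (hC j i)]; rfl)
    rw [← det_transpose, transpose_add, transpose_one, det_one_add_of_col_eq_zero (j := i),
      transpose_apply, hQii, sub_eq_add_neg]
    exact fun k l hl => Subtype.ext
      (by rw [transpose_apply, hQkl, single_mul_apply_of_ne _ _ _ _ _ hl]; rfl)
  refine ber_lower_mul_upper hP hQ ?_
  rw [hdetP, hdetQ]
  linear_combination -hc

theorem ber_mul_upper_single (h2 : IsUnit (2 : σ.even)) (hM : σ.IsEvenUnit M) (i : Fin m)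
    (j : Fin n) {b : R} (hb : b ∈ σ.odd) :
    σ.ber (M * fromBlocks 1 (single i j b) 0 1) = σ.ber M := by
  obtain ⟨A, B, C, D, hA, hB, hC, hD, rfl⟩ := hM.exists_decomposition h2
  have hL := isEvenUnit_lower (σ := σ) hC
  have hLU := hL.mul (isEvenUnit_upper (isOddMatrix_single (σ := σ) i j hb))
  have hΔ := isEvenUnit_diag (σ := σ) hA hD
  rw [Matrix.mul_assoc, Matrix.mul_assoc, ber_upper_mul hB h2 (hΔ.mul hLU),
    ber_diag_mul hD hLU, ber_lower_mul_upper_single h2 hC i j hb, Matrix.mul_assoc,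
    ber_upper_mul hB h2 (hΔ.mul hL), ber_mul_lower hC h2 hΔ, ber_diag, mul_one]

theorem ber_mul_upper (h2 : IsUnit (2 : σ.even)) (hB : σ.IsOddMatrix B) (hM : σ.IsEvenUnit M) :
    σ.ber (M * fromBlocks 1 B 0 1) = σ.ber M := by
  let p : Matrix (Fin m) (Fin n) R → Prop := fun B => σ.IsOddMatrix B ∧
    ∀ M : Matrix (Fin m ⊕ Fin n) (Fin m ⊕ Fin n) R, σ.IsEvenUnit M →
      σ.ber (M * fromBlocks 1 B 0 1) = σ.ber M
  have hadd : ∀ B B', p B → p B' → p (B + B') := by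
    rintro B B' ⟨hB, h⟩ ⟨hB', h'⟩
    refine ⟨hB.add hB', fun M hM => ?_⟩
    have hmul : fromBlocks 1 (B + B') 0 1 =
        (fromBlocks 1 B 0 1 * fromBlocks 1 B' 0 1 : Matrix (Fin m ⊕ Fin n) (Fin m ⊕ Fin n) R) := by
      simp [fromBlocks_multiply, add_comm]
    rw [hmul, ← Matrix.mul_assoc, h' _ (hM.mul (isEvenUnit_upper hB)), h M hM]
  have hzero : p 0 := ⟨isOddMatrix_zero, fun M _ => by rw [fromBlocks_one, Matrix.mul_one]⟩
  suffices h : p B from h.2 M hM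
  rw [matrix_eq_sum_single B]
  exact Finset.sum_induction _ p hadd hzero fun i _ =>
    Finset.sum_induction _ p hadd hzero fun j _ =>
      ⟨isOddMatrix_single i j (hB i j), fun M hM => ber_mul_upper_single h2 hM i j (hB i j)⟩

theorem ber_mul (h2 : IsUnit (2 : σ.even)) (hM : σ.IsEvenUnit M) (hN : σ.IsEvenUnit N) :
    σ.ber (M * N) = σ.ber M * σ.ber N := by
  obtain ⟨A, B, C, D, hA, hB, hC, hD, rfl⟩ := hN.exists_decomposition h2
  have hU := isEvenUnit_upper (σ := σ) hB
  have hΔ := isEvenUnit_diag (σ := σ) hA hD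
  rw [← Matrix.mul_assoc, ← Matrix.mul_assoc, ber_mul_lower hC h2 ((hM.mul hU).mul hΔ),
    ber_mul_diag hD (hM.mul hU), ber_mul_upper h2 hB hM, ber_mul_lower hC h2 (hU.mul hΔ),
    ber_upper_mul hB h2 hΔ, ber_diag]

theorem ber_map (h2 : IsUnit (2 : σ.even)) {R' : Type u} [Ring R'] {σ' : SuperGrading R'}
    (φ : R →+* R') (ψ : σ.even →+* σ'.even) (hψ : ∀ a, (ψ a : R') = φ a)
    (hM : σ.IsEvenUnit M) : σ'.ber (M.map φ) = ψ (σ.ber M) := by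
  obtain ⟨A, B, C, D, hB, hC, rfl⟩ := hM.1.exists_fromBlocks
  obtain ⟨-, hD⟩ := hM.isUnit_det h2 hB hC
  obtain ⟨T, hT⟩ := hB.exists_coeMatrix_eq_schur hC A D⁻¹
  have hcoe : ∀ {k : ℕ} (P : Matrix (Fin k) (Fin k) σ.even),
      (σ.coeMatrix P).map φ = σ'.coeMatrix (ψ.mapMatrix P) :=
    fun P => Matrix.ext fun i j => (hψ (P i j)).symm
  have hinv : (ψ.mapMatrix D)⁻¹ = ψ.mapMatrix D⁻¹ :=
    inv_eq_right_inv (by rw [← map_mul, mul_nonsing_inv _ hD, map_one])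
  have hinverse : Ring.inverse (ψ D.det) = ψ (Ring.inverse D.det) := by
    obtain ⟨u, hu⟩ := hD
    rw [← hu, Ring.inverse_unit]
    exact Ring.inverse_unit (Units.map (ψ : σ.even →* σ'.even) u)
  rw [ber_fromBlocks hT, fromBlocks_map, hcoe, hcoe, ber_fromBlocks (T := ψ.mapMatrix T), map_mul,
    ← RingHom.map_det, ← RingHom.map_det, hinverse]
  rw [← hcoe, hT, hinv, ← hcoe, ← hcoe, ← Matrix.map_mul, ← Matrix.map_mul,
    Matrix.map_sub _ (map_sub φ)]

end Berezinian

end SuperGrading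

section ChangeOfBasis

open Matrix

variable {R M ι κ : Type*} [Ring R] [AddCommGroup M] [Module R M] [Fintype ι] [Fintype κ]

theorem sum_vecMul_smul (c : κ → R) (P : Matrix κ ι R) (v : ι → M) :
    ∑ i, (c ᵥ* P) i • v i = ∑ j, c j • ∑ i, P j i • v i := by
  simp only [vecMul, dotProduct, Finset.sum_smul, Finset.smul_sum, mul_smul]
  exact Finset.sum_comm

theorem sum_one_smul [DecidableEq ι] (v : ι → M) (i : ι) :
    ∑ j, (1 : Matrix ι ι R) i j • v j = v i := by
  simp [one_apply]

theorem linearIndependent_sum_smul [DecidableEq κ] {P : Matrix κ ι R} {P' : Matrix ι κ R}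
    (h : P * P' = 1) {v : ι → M} (hv : LinearIndependent R v) :
    LinearIndependent R fun j => ∑ i, P j i • v i := by
  rw [Fintype.linearIndependent_iff] at hv ⊢
  intro c hc
  have hcP : c ᵥ* P = 0 := funext (hv _ (by rw [sum_vecMul_smul, hc]))
  have hzero : c = 0 := by rw [← vecMul_one c, ← h, ← vecMul_vecMul, hcP, zero_vecMul]
  exact congrFun hzero

theorem span_range_sum_smul [DecidableEq ι] {P : Matrix κ ι R} {P' : Matrix ι κ R}
    (h : P' * P = 1) {v : ι → M} (hv : Submodule.span R (Set.range v) = ⊤) :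
    Submodule.span R (Set.range fun j => ∑ i, P j i • v i) = ⊤ := by
  rw [eq_top_iff, ← hv, Submodule.span_le]
  rintro _ ⟨i, rfl⟩
  have hi : v i = ∑ j, P' i j • ∑ k, P j k • v k := by
    rw [← sum_vecMul_smul, ← mul_apply_eq_vecMul, h, sum_one_smul]
  rw [SetLike.mem_coe, hi]
  exact sum_mem fun j _ => Submodule.smul_mem _ _ (Submodule.subset_span ⟨j, rfl⟩)

end ChangeOfBasis

namespace SuperGrading

variable {R : Type u} [Ring R] {σ : SuperGrading R}

theorem isUnit_of_coe_mul_eq_one {a : σ.even} {b : R} (h : a * b = 1) : IsUnit a := by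
  have hodd := σ.even_mul_odd a a.2 _ (σ.sub_evenPart_mem_odd b)
  rw [mul_sub, h] at hodd
  have hone := sub_eq_zero.1
    (σ.eq_zero_of_mem_even_of_mem_odd (sub_mem (one_mem _) (a * σ.evenPart b).2) hodd)
  exact .of_mul_eq_one _ (Subtype.ext hone.symm)

theorem isUnit_det_of_mul_coeMatrix_eq_one {ι : Type*} [Fintype ι] [DecidableEq ι]
    {X : Matrix ι ι σ.even} {C : Matrix ι ι R} (h : C * σ.coeMatrix X = 1) : IsUnit X.det := by
  let Y : Matrix ι ι σ.even := Matrix.of fun i j => σ.evenPart (C i j)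
  have hodd : σ.IsOddMatrix (1 - σ.coeMatrix (Y * X)) := by
    have hCY : σ.IsOddMatrix (C - σ.coeMatrix Y) := fun i j => σ.sub_evenPart_mem_odd (C i j)
    rw [← h, map_mul, ← Matrix.sub_mul]
    exact hCY.mul_coeMatrix X
  have heven : ∀ i j, (1 - σ.coeMatrix (Y * X)) i j ∈ σ.even := by
    rw [← map_one σ.coeMatrix, ← map_sub]
    exact fun i j => Subtype.prop _
  have hzero : 1 - σ.coeMatrix (Y * X) = 0 :=
    Matrix.ext fun i j => σ.eq_zero_of_mem_even_of_mem_odd (heven i j) (hodd i j)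
  have hYX : Y * X = 1 := Matrix.map_injective Subtype.val_injective
    ((sub_eq_zero.1 hzero).symm.trans (map_one σ.coeMatrix).symm)
  exact Matrix.isUnit_det_of_left_inverse hYX

end SuperGrading

namespace Superspace

variable (S : Superspace.{u})

theorem isUnit_two (W : Opens S.X) : IsUnit (2 : S.evenFn W) := by
  have h : IsUnit (2 : ℂ) := two_ne_zero.isUnit
  simpa only [map_ofNat] using h.map ((S.evenRes (le_top : W ≤ ⊤)).comp S.ofComplex)

theorem res_res {W W' W'' : Opens S.X} (h : W' ≤ W) (h' : W'' ≤ W') (a : S.fn W) :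
    S.res h' (S.res h a) = S.res (h'.trans h) a := by
  change ((S.sheaf.presheaf.map (homOfLE h).op) ≫ (S.sheaf.presheaf.map (homOfLE h').op)).hom a = _
  rw [← S.sheaf.presheaf.map_comp]
  rfl

theorem coe_evenRes {W W' : Opens S.X} (h : W' ≤ W) (a : S.evenFn W) :
    (S.evenRes h a : S.fn W') = S.res h a := rfl

theorem evenRes_evenRes {W W' W'' : Opens S.X} (h : W' ≤ W) (h' : W'' ≤ W') (a : S.evenFn W) :
    S.evenRes h' (S.evenRes h a) = S.evenRes (h'.trans h) a := Subtype.ext (S.res_res h h' a)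

variable {S} {m n : ℕ} {W W' : Opens S.X} (h : W' ≤ W)

open Matrix

theorem isOddMatrix_map_res {ι κ : Type*} {B : Matrix ι κ (S.fn W)}
    (hB : (S.grading W).IsOddMatrix B) : (S.grading W').IsOddMatrix (B.map (S.res h)) :=
  fun i j => S.map_odd W W' h _ (hB i j)

theorem fromBlocks_map_res (A : Matrix (Fin m) (Fin m) (S.evenFn W))
    (B : Matrix (Fin m) (Fin n) (S.fn W)) (C : Matrix (Fin n) (Fin m) (S.fn W))
    (D : Matrix (Fin n) (Fin n) (S.evenFn W)) :
    (fromBlocks ((S.grading W).coeMatrix A) B C ((S.grading W).coeMatrix D)).map (S.res h) =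
      fromBlocks ((S.grading W').coeMatrix ((S.evenRes h).mapMatrix A)) (B.map (S.res h))
        (C.map (S.res h)) ((S.grading W').coeMatrix ((S.evenRes h).mapMatrix D)) :=
  fromBlocks_map _ _ _ _ _

theorem ber_map_res {P : Matrix (Fin m ⊕ Fin n) (Fin m ⊕ Fin n) (S.fn W)}
    (hP : (S.grading W).IsEvenUnit P) :
    (S.grading W').ber (P.map (S.res h)) = S.evenRes h ((S.grading W).ber P) :=
  SuperGrading.ber_map (S.isUnit_two W) (S.res h) (S.evenRes h) (fun _ => rfl) hP

end Superspace

namespace SuperModule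

open Matrix

variable {S : Superspace.{u}} {M N E F : SuperModule S} {W W' : Opens S.X}

/-- The homogeneous component of a parity: `false` is even, `true` is odd. -/
def homog (M : SuperModule S) (W : Opens S.X) : Bool → AddSubgroup (M.obj W)
  | false => M.even W
  | true => M.odd W

theorem smul_mem_homog {p q : Bool} {a : S.fn W} {v : M.obj W}
    (ha : a ∈ (S.grading W).homog p) (hv : v ∈ M.homog W q) : a • v ∈ M.homog W (p ^^ q) := by
  cases p <;> cases q
  exacts [M.even_smul_even W a ha v hv, M.even_smul_odd W a ha v hv, M.odd_smul_even W a ha v hv,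
    M.odd_smul_odd W a ha v hv]

theorem sum_smul_mem_homog {ι : Type*} [Fintype ι] {b : Bool} {p : ι → Bool} {c : ι → S.fn W}
    {v : ι → M.obj W} (hc : ∀ i, c i ∈ (S.grading W).homog (b ^^ p i))
    (hv : ∀ i, v i ∈ M.homog W (p i)) : ∑ i, c i • v i ∈ M.homog W b :=
  sum_mem fun i _ => by
    have hi := smul_mem_homog (hc i) (hv i)
    rwa [Bool.xor_assoc, Bool.xor_self, Bool.xor_false] at hi

theorem res_mem_homog (h : W' ≤ W) {p : Bool} {v : M.obj W} (hv : v ∈ M.homog W p) :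
    M.res h v ∈ M.homog W' p := by
  cases p
  exacts [M.res_even h v hv, M.res_odd h v hv]

theorem eq_zero_of_mem_homog {p : Bool} {v : M.obj W} (h : v ∈ M.homog W p)
    (h' : v ∈ M.homog W (!p)) : v = 0 := by
  cases p
  exacts [AddSubgroup.disjoint_def.1 (M.isCompl W).disjoint h h',
    AddSubgroup.disjoint_def.1 (M.isCompl W).disjoint h' h]

theorem exists_even_add_odd (v : M.obj W) : ∃ v₀ ∈ M.even W, ∃ v₁ ∈ M.odd W, v = v₀ + v₁ := by
  have h : v ∈ M.even W ⊔ M.odd W := by rw [(M.isCompl W).sup_eq_top]; trivial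
  obtain ⟨b, hb, c, hc, rfl⟩ := AddSubgroup.mem_sup.1 h
  exact ⟨b, hb, c, hc, rfl⟩

namespace Frame

variable {p q : ℕ} (e : M.Frame p q W)

theorem basis_apply (i : Fin p ⊕ Fin q) : e.basis i = e.vec i :=
  Module.Basis.mk_apply _ _ i

theorem vec_mem_homog (i : Fin p ⊕ Fin q) : e.vec i ∈ M.homog W i.isRight := by
  rcases i with i | i
  exacts [e.even i, e.odd i]

theorem sum_repr (v : M.obj W) : ∑ i, e.basis.repr v i • e.vec i = v := by
  simp only [← e.basis_apply]
  exact e.basis.sum_repr v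

theorem repr_sum (c : Fin p ⊕ Fin q → S.fn W) (i : Fin p ⊕ Fin q) :
    e.basis.repr (∑ i, c i • e.vec i) i = c i := by
  simp only [← e.basis_apply]
  exact congrFun (e.basis.repr_sum_self c) i

/-- Otherwise the components of the wrong parity would give a relation between the vectors. -/
theorem repr_mem_homog {b : Bool} {v : M.obj W} (hv : v ∈ M.homog W b) (i : Fin p ⊕ Fin q) :
    e.basis.repr v i ∈ (S.grading W).homog (b ^^ i.isRight) := by
  choose c₀ h₀ c₁ h₁ hc using fun i =>
    (S.grading W).exists_homog_add (b ^^ i.isRight) (e.basis.repr v i)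
  have hsum : v = ∑ i, c₀ i • e.vec i + ∑ i, c₁ i • e.vec i := by
    rw [← Finset.sum_add_distrib]
    simp only [← add_smul, ← hc, e.sum_repr]
  have hv₀ : ∑ i, c₀ i • e.vec i ∈ M.homog W b := sum_smul_mem_homog h₀ e.vec_mem_homog
  have hv₁ : ∑ i, c₁ i • e.vec i ∈ M.homog W (!b) :=
    sum_smul_mem_homog (fun i => by rw [Bool.not_xor]; exact h₁ i) e.vec_mem_homog
  have hz : ∑ i, c₁ i • e.vec i = 0 := by
    refine eq_zero_of_mem_homog ?_ hv₁
    rw [← sub_eq_of_eq_add' hsum]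
    exact sub_mem hv hv₀
  rw [hz, add_zero] at hsum
  rw [hsum, e.repr_sum]
  exact h₀ i

theorem coords_eq {v : Fin p ⊕ Fin q → M.obj W}
    {P : Matrix (Fin p ⊕ Fin q) (Fin p ⊕ Fin q) (S.fn W)} (h : ∀ j, v j = ∑ i, P j i • e.vec i) :
    e.coords v = P :=
  Matrix.ext fun j i => by rw [coords, of_apply, h, e.repr_sum]

theorem sum_coords (v : Fin p ⊕ Fin q → M.obj W) (j : Fin p ⊕ Fin q) :
    ∑ i, e.coords v j i • e.vec i = v j := e.sum_repr _

theorem coords_mul (e' : M.Frame p q W) (v : Fin p ⊕ Fin q → M.obj W) :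
    e'.coords v * e.coords e'.vec = e.coords v := by
  refine (e.coords_eq fun j => ?_).symm
  rw [mul_apply_eq_vecMul, sum_vecMul_smul]
  simp only [sum_coords]

theorem coords_self : e.coords e.vec = 1 :=
  e.coords_eq fun j => (sum_one_smul _ j).symm

theorem isEvenMatrix_coords {v : Fin p ⊕ Fin q → M.obj W}
    (hv : ∀ j, v j ∈ M.homog W j.isRight) : (S.grading W).IsEvenMatrix (e.coords v) :=
  fun j i => e.repr_mem_homog (hv j) i

theorem isEvenUnit_coords (e' : M.Frame p q W) : (S.grading W).IsEvenUnit (e.coords e'.vec) :=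
  ⟨e.isEvenMatrix_coords e'.vec_mem_homog, e'.coords e.vec, e'.isEvenMatrix_coords e.vec_mem_homog,
    by rw [coords_mul, coords_self], by rw [coords_mul, coords_self]⟩

theorem ber_coords_mul (e' e'' : M.Frame p q W) :
    (S.grading W).ber (e'.coords e''.vec) * (S.grading W).ber (e.coords e'.vec) =
      (S.grading W).ber (e.coords e''.vec) := by
  rw [← SuperGrading.ber_mul (S.isUnit_two W) (isEvenUnit_coords _ _) (isEvenUnit_coords _ _),
    coords_mul]

theorem ber_coords_mul_ber_coords (e' : M.Frame p q W) :
    (S.grading W).ber (e.coords e'.vec) * (S.grading W).ber (e'.coords e.vec) = 1 := by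
  rw [ber_coords_mul, coords_self, SuperGrading.ber_one]

theorem restrict_vec (h : W' ≤ W) (i : Fin p ⊕ Fin q) :
    (e.restrict h).vec i = M.res h (e.vec i) := rfl

theorem restrict_restrict {W'' : Opens S.X} (h : W' ≤ W) (h' : W'' ≤ W') :
    (e.restrict h).restrict h' = e.restrict (h'.trans h) := by
  simp only [restrict, M.res_res]

theorem repr_restrict (h : W' ≤ W) (v : M.obj W) (i : Fin p ⊕ Fin q) :
    (e.restrict h).basis.repr (M.res h v) i = S.res h (e.basis.repr v i) := by
  conv_lhs => rw [← e.sum_repr v, map_sum]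
  simp only [M.res_smul, ← restrict_vec]
  exact (e.restrict h).repr_sum _ i

theorem coords_restrict (h : W' ≤ W) (v : Fin p ⊕ Fin q → M.obj W) :
    (e.restrict h).coords (fun j => M.res h (v j)) = (e.coords v).map (S.res h) :=
  Matrix.ext fun j i => e.repr_restrict h (v j) i

theorem res_sum_smul {P : Matrix (Fin p ⊕ Fin q) (Fin p ⊕ Fin q) (S.fn W)} (h : W' ≤ W)
    (j : Fin p ⊕ Fin q) :
    M.res h (∑ i, P j i • e.vec i) = ∑ i, P.map (S.res h) j i • M.res h (e.vec i) := by
  simp only [map_sum, M.res_smul, map_apply]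

/-- The frame obtained from another by an even invertible matrix. -/
noncomputable def change (P : Matrix (Fin p ⊕ Fin q) (Fin p ⊕ Fin q) (S.fn W))
    (hP : (S.grading W).IsEvenUnit P) : M.Frame p q W where
  vec j := ∑ i, P j i • e.vec i
  even i := sum_smul_mem_homog (b := false) (hP.1 (.inl i)) e.vec_mem_homog
  odd j := sum_smul_mem_homog (b := true) (hP.1 (.inr j)) e.vec_mem_homog
  linearIndependent W' h := by
    obtain ⟨-, P', -, hPP', -⟩ := hP
    simp only [res_sum_smul]
    refine linearIndependent_sum_smul (P' := P'.map (S.res h)) ?_ (e.linearIndependent W' h)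
    rw [← Matrix.map_mul, hPP', Matrix.map_one _ (map_zero _) (map_one _)]
  span_eq_top W' h := by
    obtain ⟨-, P', -, -, hP'P⟩ := hP
    simp only [res_sum_smul]
    refine span_range_sum_smul (P' := P'.map (S.res h)) ?_ (e.span_eq_top W' h)
    rw [← Matrix.map_mul, hP'P, Matrix.map_one _ (map_zero _) (map_one _)]

theorem coords_change {P : Matrix (Fin p ⊕ Fin q) (Fin p ⊕ Fin q) (S.fn W)}
    (hP : (S.grading W).IsEvenUnit P) : e.coords (e.change P hP).vec = P :=
  e.coords_eq fun _ => rfl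

theorem change_coords {P P' : Matrix (Fin p ⊕ Fin q) (Fin p ⊕ Fin q) (S.fn W)}
    (hP : (S.grading W).IsEvenUnit P) (h : P * P' = 1) : (e.change P hP).coords e.vec = P' := by
  have hinv := e.coords_mul (e.change P hP) e.vec
  rw [coords_change, coords_self] at hinv
  exact left_inv_eq_right_inv hinv h

/-- The morphism with prescribed values on a frame. -/
noncomputable def hom (w : Fin p ⊕ Fin q → N.obj W) (hw : ∀ i, w i ∈ N.homog W i.isRight) :
    HomOver W M N where
  app W' h :=
    { toFun := fun v => ∑ i, (e.restrict h).basis.repr v i • N.res h (w i)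
      map_add' := fun v v' => by
        simp only [map_add, Finsupp.add_apply, add_smul, Finset.sum_add_distrib]
      map_smul' := fun a v => by
        simp only [map_smul, Finsupp.smul_apply, smul_eq_mul, mul_smul, Finset.smul_sum,
          RingHom.id_apply] }
  app_res W' W'' h h' v := by
    simp only [LinearMap.coe_mk, AddHom.coe_mk, map_sum, N.res_smul, N.res_res,
      ← e.restrict_restrict h h', repr_restrict]
  app_even W' h _ hv := sum_smul_mem_homog (b := false)
    ((e.restrict h).repr_mem_homog (b := false) hv) fun i => res_mem_homog h (hw i)
  app_odd W' h _ hv := sum_smul_mem_homog (b := true)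
    ((e.restrict h).repr_mem_homog (b := true) hv) fun i => res_mem_homog h (hw i)

theorem hom_app_vec (w : Fin p ⊕ Fin q → N.obj W) (hw : ∀ i, w i ∈ N.homog W i.isRight)
    (i : Fin p ⊕ Fin q) : (e.hom w hw).app W le_rfl (e.vec i) = w i := by
  change ∑ j, (e.restrict le_rfl).basis.repr (e.vec i) j • N.res le_rfl (w j) = w i
  have hrepr : ∀ j, (e.restrict le_rfl).basis.repr (e.vec i) j = (1 : Matrix _ _ (S.fn W)) i j := by
    intro j
    rw [← congrFun (congrFun (coords_self (e.restrict le_rfl)) i) j, coords, of_apply, restrict_vec,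
      M.res_self]
  simp only [hrepr, N.res_self]
  exact sum_one_smul w i

end Frame

namespace HomOver

variable {m n : ℕ}

theorem app_mem_homog (d : HomOver W M N) (h : W' ≤ W) {p : Bool} {v : M.obj W'}
    (hv : v ∈ M.homog W' p) : d.app W' h v ∈ N.homog W' p := by
  cases p
  exacts [d.app_even W' h v hv, d.app_odd W' h v hv]

/-- The restriction of a morphism to a smaller open subset. -/
def restrict (d : HomOver W M N) (h : W' ≤ W) : HomOver W' M N where
  app W'' h' := d.app W'' (h'.trans h)
  app_res W₁ W₂ h₁ h₂ := d.app_res W₁ W₂ (h₁.trans h) h₂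
  app_even W'' h' := d.app_even W'' (h'.trans h)
  app_odd W'' h' := d.app_odd W'' (h'.trans h)

/-- The composition of morphisms. -/
def comp (k : HomOver W N E) (d : HomOver W M N) : HomOver W M E where
  app W' h := (k.app W' h).comp (d.app W' h)
  app_res W' W'' h h' v := by
    simp only [LinearMap.comp_apply, d.app_res W' W'' h h', k.app_res W' W'' h h']
  app_even W' h v hv := k.app_even W' h _ (d.app_even W' h v hv)
  app_odd W' h v hv := k.app_odd W' h _ (d.app_odd W' h v hv)

theorem app_eq_smul_of_vec (φ : HomOver W M M) (e : M.Frame m n W) {f : S.evenFn W}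
    (hφ : ∀ i, φ.app W le_rfl (e.vec i) = (f : S.fn W) • e.vec i) (h : W' ≤ W) (v : M.obj W') :
    φ.app W' h v = (S.evenRes h f : S.fn W') • v := by
  have hvec : ∀ i, φ.app W' h ((e.restrict h).vec i) =
      (S.evenRes h f : S.fn W') • (e.restrict h).vec i := fun i => by
    rw [Frame.restrict_vec, φ.app_res W W' le_rfl h, hφ, M.res_smul, S.coe_evenRes]
  rw [← (e.restrict h).sum_repr v]
  simp only [map_sum, map_smul, hvec, Finset.smul_sum, smul_smul]
  exact Finset.sum_congr rfl fun i _ => by rw [(S.grading W').even_comm _ (S.evenRes h f).2]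

/-- The matrix of a morphism in a pair of frames. -/
noncomputable def matrix (d : HomOver ⊤ E F) (e : E.Frame m n W) (g : F.Frame m n W) :
    Matrix (Fin m ⊕ Fin n) (Fin m ⊕ Fin n) (S.fn W) :=
  g.coords fun j => d.app W le_top (e.vec j)

variable (d : HomOver ⊤ E F) (e e' : E.Frame m n W) (g g' : F.Frame m n W)

theorem theta_eq_ber_matrix : theta d e g = (S.grading W).ber (d.matrix e g) := rfl

theorem isEvenMatrix_matrix : (S.grading W).IsEvenMatrix (d.matrix e g) :=
  g.isEvenMatrix_coords fun j => d.app_mem_homog le_top (e.vec_mem_homog j)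

theorem sum_matrix (i : Fin m ⊕ Fin n) :
    ∑ j, d.matrix e g i j • g.vec j = d.app W le_top (e.vec i) :=
  g.sum_coords (fun j => d.app W le_top (e.vec j)) i

theorem app_sum_smul (c : Fin m ⊕ Fin n → S.fn W) :
    d.app W le_top (∑ i, c i • e.vec i) = ∑ j, (c ᵥ* d.matrix e g) j • g.vec j := by
  simp only [sum_vecMul_smul, sum_matrix, map_sum, map_smul]

theorem coords_app (v : Fin m ⊕ Fin n → E.obj W) :
    g.coords (fun j => d.app W le_top (v j)) = e.coords v * d.matrix e g :=
  g.coords_eq fun j => by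
    rw [mul_apply_eq_vecMul, ← app_sum_smul, e.sum_coords]

theorem matrix_change :
    d.matrix e' g' = e.coords e'.vec * d.matrix e g * g'.coords g.vec := by
  rw [Matrix.mul_assoc, matrix, matrix, Frame.coords_mul, coords_app d e]
  rfl

theorem matrix_restrict (h : W' ≤ W) :
    d.matrix (e.restrict h) (g.restrict h) = (d.matrix e g).map (S.res h) := by
  rw [matrix, matrix, ← Frame.coords_restrict]
  exact congrArg _ (funext fun j => d.app_res W W' le_top h _)

variable {d e g}

theorem matrix_restrict_eq_fromBlocks {X : Matrix (Fin n) (Fin n) (S.evenFn W)}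
    (hX : d.matrix e g = fromBlocks 1 0 0 ((S.grading W).coeMatrix X)) (h : W' ≤ W) :
    d.matrix (e.restrict h) (g.restrict h) =
      fromBlocks 1 0 0 ((S.grading W').coeMatrix ((S.evenRes h).mapMatrix X)) := by
  rw [matrix_restrict, hX, ← map_one (S.grading W).coeMatrix, Superspace.fromBlocks_map_res,
    map_one, map_one, Matrix.map_zero _ (map_zero _), Matrix.map_zero _ (map_zero _)]

theorem theta_change (h : (S.grading W).IsEvenUnit (d.matrix e g)) :
    theta d e' g' = (S.grading W).ber (e.coords e'.vec) * theta d e g *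
      (S.grading W).ber (g'.coords g.vec) := by
  rw [theta_eq_ber_matrix, theta_eq_ber_matrix, matrix_change d e e' g g',
    SuperGrading.ber_mul (S.isUnit_two W) ((Frame.isEvenUnit_coords _ _).mul h)
      (Frame.isEvenUnit_coords _ _),
    SuperGrading.ber_mul (S.isUnit_two W) (Frame.isEvenUnit_coords _ _) h]

theorem isUnit_det_of_surjective {X : Matrix (Fin n) (Fin n) (S.evenFn W)}
    (hX : d.matrix e g = fromBlocks 1 0 0 ((S.grading W).coeMatrix X))
    (hd : Function.Surjective (d.app W le_top)) : IsUnit X.det := by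
  choose w hw using fun j => hd (g.vec j)
  have hmul : e.coords w * d.matrix e g = 1 := by
    rw [← coords_app, ← g.coords_self]
    simp only [hw]
  rw [hX, ← fromBlocks_toBlocks (e.coords w), fromBlocks_multiply, ← fromBlocks_one,
    fromBlocks_inj] at hmul
  refine SuperGrading.isUnit_det_of_mul_coeMatrix_eq_one (C := (e.coords w).toBlocks₂₂) ?_
  simpa only [Matrix.mul_zero, zero_add] using hmul.2.2.2

end HomOver

namespace BerSection

variable {m n : ℕ} {d : HomOver ⊤ E F} (e : E.Frame m n W) (g : F.Frame m n W)

/-- The section of the Berezinian line bundle with coefficient `c` at a pair of frames. -/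
noncomputable def ofFrames (c : S.evenFn W) : BerSection E F m n W where
  coeff {W'} h e' g' := S.evenRes h c * (S.grading W').ber ((g.restrict h).coords g'.vec) *
    (S.grading W').ber (e'.coords (e.restrict h).vec)
  coeff_res {W' W''} h h' e' g' := by
    rw [map_mul, map_mul, S.evenRes_evenRes,
      ← Superspace.ber_map_res h' (Frame.isEvenUnit_coords _ _),
      ← Superspace.ber_map_res h' (Frame.isEvenUnit_coords _ _), ← Frame.coords_restrict,
      ← Frame.coords_restrict, ← Frame.restrict_restrict g h h', ← Frame.restrict_restrict e h h']
    rfl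
  coeff_change {W'} h e₁ e₂ g₁ g₂ := by
    rw [← Frame.ber_coords_mul (g.restrict h) g₁ g₂, ← Frame.ber_coords_mul e₁ e₂]
    ring

theorem coeff_ofFrames (c : S.evenFn W) (h : W' ≤ W) (e' : E.Frame m n W') (g' : F.Frame m n W') :
    (ofFrames e g c).coeff h e' g' =
      S.evenRes h c * (S.grading W').ber ((g.restrict h).coords g'.vec) *
        (S.grading W').ber (e'.coords (e.restrict h).vec) := rfl

theorem isTrivialization_ofFrames {c : S.evenFn W} (hc : IsUnit c) :
    (ofFrames e g c).IsTrivialization :=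
  fun h _ _ => ((hc.map (S.evenRes h)).mul
    (.of_mul_eq_one _ (Frame.ber_coords_mul_ber_coords _ _))).mul
      (.of_mul_eq_one _ (Frame.ber_coords_mul_ber_coords _ _))

variable {e g}

theorem theta_mul_coeff_ofFrames (c : S.evenFn W) (h : W' ≤ W)
    (hd : (S.grading W').IsEvenUnit (d.matrix (e.restrict h) (g.restrict h)))
    (e' : E.Frame m n W') (g' : F.Frame m n W') :
    theta d e' g' * (ofFrames e g c).coeff h e' g' =
      theta d (e.restrict h) (g.restrict h) * S.evenRes h c := by
  rw [HomOver.theta_change e' g' hd, coeff_ofFrames]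
  linear_combination theta d (e.restrict h) (g.restrict h) * S.evenRes h c *
    ((S.grading W').ber (g'.coords (g.restrict h).vec) *
      (S.grading W').ber ((g.restrict h).coords g'.vec) *
        Frame.ber_coords_mul_ber_coords (e.restrict h) e' +
      Frame.ber_coords_mul_ber_coords g' (g.restrict h))

theorem theta_mul_sq_mul_coeff_ofFrames {X : Matrix (Fin n) (Fin n) (S.evenFn W)}
    (hX : d.matrix e g = fromBlocks 1 0 0 ((S.grading W).coeMatrix X)) {f c : S.evenFn W}
    (hf : f ^ 2 * c = X.det) (h : W' ≤ W) (hd : Function.Surjective (d.app W' le_top))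
    (e' : E.Frame m n W') (g' : F.Frame m n W') :
    theta d e' g' * (S.evenRes h f ^ 2 * (ofFrames e g c).coeff h e' g') = 1 := by
  let X' : Matrix (Fin n) (Fin n) (S.evenFn W') := (S.evenRes h).mapMatrix X
  have hX' := HomOver.matrix_restrict_eq_fromBlocks hX h
  have hu : IsUnit X'.det := HomOver.isUnit_det_of_surjective hX' hd
  have hdet : S.evenRes h f ^ 2 * S.evenRes h c = X'.det := by
    rw [← map_pow, ← map_mul, hf, RingHom.map_det]
  rw [← map_one (S.grading W').coeMatrix] at hX'
  have heven : (S.grading W').IsEvenUnit (d.matrix (e.restrict h) (g.restrict h)) := by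
    rw [hX']
    exact SuperGrading.isEvenUnit_diag (by rw [det_one]; exact isUnit_one) hu
  calc
    _ = S.evenRes h f ^ 2 * (theta d e' g' * (ofFrames e g c).coeff h e' g') := mul_left_comm _ _ _
    _ = Ring.inverse X'.det * X'.det := by
      rw [theta_mul_coeff_ofFrames c h heven, HomOver.theta_eq_ber_matrix, hX',
        SuperGrading.ber_diag, det_one, one_mul, mul_left_comm, hdet]
    _ = 1 := Ring.inverse_mul_cancel _ hu

end BerSection

section Homotopy

variable {m n : ℕ} {d : HomOver ⊤ E F} {e : E.Frame m n W} {g : F.Frame m n W} {f : S.evenFn W}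

theorem exists_homotopy_of_matrix {P : Matrix (Fin m ⊕ Fin n) (Fin m ⊕ Fin n) (S.fn W)}
    (hP : (S.grading W).IsEvenMatrix P) (hdP : d.matrix e g * P = diagonal fun _ => (f : S.fn W))
    (hPd : P * d.matrix e g = diagonal fun _ => (f : S.fn W)) :
    ∃ k : HomOver W F E, ∀ (W' : Opens S.X) (h : W' ≤ W),
      (∀ v, k.app W' h (d.app W' le_top v) = (S.evenRes h f : S.fn W') • v) ∧
      (∀ y, d.app W' le_top (k.app W' h y) = (S.evenRes h f : S.fn W') • y) := by
  let k : HomOver W F E := g.hom (fun i => ∑ j, P i j • e.vec j)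
    fun i => sum_smul_mem_homog (hP i) e.vec_mem_homog
  have hk : ∀ i, k.app W le_rfl (g.vec i) = ∑ j, P i j • e.vec j := g.hom_app_vec _ _
  have hdiag : ∀ {M : SuperModule S} (e : M.Frame m n W) (i : Fin m ⊕ Fin n),
      ∑ j, diagonal (fun _ => (f : S.fn W)) i j • e.vec j = (f : S.fn W) • e.vec i :=
    fun e i => by simp [diagonal_apply]
  refine ⟨k, fun W' h => ⟨fun v => ?_, fun y => ?_⟩⟩
  · refine (k.comp (d.restrict le_top)).app_eq_smul_of_vec e (fun i => ?_) h v
    change k.app W le_rfl (d.app W le_top (e.vec i)) = _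
    rw [← d.sum_matrix e g, map_sum]
    simp only [map_smul, hk]
    rw [← sum_vecMul_smul, ← mul_apply_eq_vecMul, hdP, hdiag]
  · refine ((d.restrict le_top).comp k).app_eq_smul_of_vec g (fun i => ?_) h y
    change d.app W le_top (k.app W le_rfl (g.vec i)) = _
    rw [hk, d.app_sum_smul e g, ← mul_apply_eq_vecMul, hPd, hdiag]

theorem exists_homotopy {X K : Matrix (Fin n) (Fin n) (S.evenFn W)}
    (hX : d.matrix e g = fromBlocks 1 0 0 ((S.grading W).coeMatrix X))
    (hXK : X * K = f • (1 : Matrix _ _ _)) (hKX : K * X = f • (1 : Matrix _ _ _)) :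
    ∃ k : HomOver W F E, ∀ (W' : Opens S.X) (h : W' ≤ W),
      (∀ v, k.app W' h (d.app W' le_top v) = (S.evenRes h f : S.fn W') • v) ∧
      (∀ y, d.app W' le_top (k.app W' h y) = (S.evenRes h f : S.fn W') • y) := by
  let σ := S.grading W
  have hscalar : ∀ p : ℕ, σ.coeMatrix (f • (1 : Matrix (Fin p) (Fin p) σ.even)) =
      diagonal fun _ => (f : S.fn W) := fun p => by
    rw [smul_one_eq_diagonal]
    exact diagonal_map (map_zero σ.even.subtype)
  have hdiag : fromBlocks (σ.coeMatrix (f • (1 : Matrix (Fin m) (Fin m) σ.even))) 0 0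
      (σ.coeMatrix (f • (1 : Matrix (Fin n) (Fin n) σ.even))) =
        diagonal fun _ => (f : S.fn W) := by
    rw [hscalar, hscalar, fromBlocks_diagonal]
    exact congrArg diagonal (funext fun i => by cases i <;> rfl)
  refine exists_homotopy_of_matrix (e := e) (g := g)
    (P := fromBlocks (σ.coeMatrix (f • (1 : Matrix (Fin m) (Fin m) σ.even))) 0 0 (σ.coeMatrix K))
    (SuperGrading.isEvenMatrix_fromBlocks SuperGrading.isOddMatrix_zero
      SuperGrading.isOddMatrix_zero) ?_ ?_
  all_goals
    rw [hX, fromBlocks_multiply]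
    simp only [Matrix.one_mul, Matrix.mul_one, Matrix.zero_mul, Matrix.mul_zero, add_zero,
      zero_add, ← map_mul, σ]
  · rw [hXK]
    exact hdiag
  · rw [hKX]
    exact hdiag

end Homotopy

end SuperModule

theorem mul_mem_nonunits_of_isLocalRing {R : Type*} [Ring R] [IsLocalRing R] {a : R}
    (ha : a ∈ nonunits R) (b : R) : a * b ∈ nonunits R := by
  intro h
  obtain ⟨c, hc⟩ := h.exists_right_inv
  rw [mul_assoc] at hc
  set b' := b * c
  rcases IsLocalRing.isUnit_or_isUnit_of_add_one (add_sub_cancel (b' * a) 1) with h | h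
  · obtain ⟨d, hd⟩ := h.exists_left_inv
    rw [← mul_assoc] at hd
    exact ha ⟨⟨a, b', hc, by rwa [left_inv_eq_right_inv hd hc] at hd⟩, rfl⟩
  · have hz : (1 - b' * a) * b' = 0 := by rw [sub_mul, mul_assoc, hc, one_mul, mul_one, sub_self]
    rw [h.mul_right_eq_zero.1 hz, mul_zero] at hc
    exact zero_ne_one hc

namespace Superspace

open Matrix

variable (S : Superspace.{u}) {x : S.X} {W : Opens S.X}

/-- The stalk of the structure sheaf. -/
abbrev stalk (x : S.X) : Type u := S.sheaf.presheaf.stalk x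

/-- The germ of a function at a point. -/
noncomputable def germ (hx : x ∈ W) : S.fn W →+* S.stalk x := (S.sheaf.presheaf.germ W x hx).hom

instance (x : S.X) : IsLocalRing (S.stalk x) := S.isLocalRing x

theorem germ_res {W' : Opens S.X} (h : W' ≤ W) (hx : x ∈ W') (a : S.fn W) :
    S.germ hx (S.res h a) = S.germ (h hx) a :=
  TopCat.Presheaf.germ_res_apply S.sheaf.presheaf (homOfLE h) x hx a

theorem exists_germ_eq (z : S.stalk x) : ∃ (W : Opens S.X) (hx : x ∈ W) (a : S.fn W),
    S.germ hx a = z :=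
  TopCat.Presheaf.exists_germ_eq S.sheaf.presheaf z

theorem exists_res_eq_of_germ_eq {hx : x ∈ W} {a b : S.fn W} (h : S.germ hx a = S.germ hx b) :
    ∃ (W' : Opens S.X) (hW : W' ≤ W), x ∈ W' ∧ S.res hW a = S.res hW b := by
  obtain ⟨W', hx', i, _, e⟩ := TopCat.Presheaf.germ_eq S.sheaf.presheaf x hx hx a b h
  exact ⟨W', i.le, hx', e⟩

theorem exists_isUnit_evenRes {hx : x ∈ W} {a : S.evenFn W} (h : IsUnit (S.germ hx a)) :
    ∃ (W' : Opens S.X) (hW : W' ≤ W), x ∈ W' ∧ IsUnit (S.evenRes hW a) := by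
  obtain ⟨z, hz⟩ := h.exists_right_inv
  obtain ⟨W₁, hx₁, b, rfl⟩ := S.exists_germ_eq z
  have hx₂ : x ∈ W ⊓ W₁ := Opens.mem_inf.2 ⟨hx, hx₁⟩
  have hab : S.germ hx₂ (S.res inf_le_left (a : S.fn W) * S.res inf_le_right b) =
      S.germ hx₂ 1 := by
    rw [map_mul, S.germ_res, S.germ_res, hz, map_one]
  obtain ⟨W', hW, hx', hres⟩ := S.exists_res_eq_of_germ_eq hab
  rw [map_mul, S.res_res, map_one] at hres
  exact ⟨W', hW.trans inf_le_left, hx', SuperGrading.isUnit_of_coe_mul_eq_one hres⟩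

/-- The germs of even functions, as a commutative subring of the stalk. -/
def evenStalk (x : S.X) : Subring (S.stalk x) where
  carrier := {z | ∃ (W : Opens S.X) (hx : x ∈ W) (a : S.evenFn W), S.germ hx a = z}
  mul_mem' := by
    rintro _ _ ⟨W, hx, a, rfl⟩ ⟨W', hx', a', rfl⟩
    refine ⟨W ⊓ W', Opens.mem_inf.2 ⟨hx, hx'⟩,
      S.evenRes inf_le_left a * S.evenRes inf_le_right a', ?_⟩
    rw [Subring.coe_mul, map_mul, S.coe_evenRes, S.coe_evenRes, S.germ_res, S.germ_res]
  add_mem' := by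
    rintro _ _ ⟨W, hx, a, rfl⟩ ⟨W', hx', a', rfl⟩
    refine ⟨W ⊓ W', Opens.mem_inf.2 ⟨hx, hx'⟩,
      S.evenRes inf_le_left a + S.evenRes inf_le_right a', ?_⟩
    rw [Subring.coe_add, map_add, S.coe_evenRes, S.coe_evenRes, S.germ_res, S.germ_res]
  one_mem' := ⟨⊤, trivial, 1, map_one _⟩
  zero_mem' := ⟨⊤, trivial, 0, map_zero _⟩
  neg_mem' := by
    rintro _ ⟨W, hx, a, rfl⟩
    exact ⟨W, hx, -a, map_neg _ _⟩

noncomputable instance (x : S.X) : CommRing (S.evenStalk x) :=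
  { (inferInstance : Ring (S.evenStalk x)) with
    mul_comm := by
      rintro ⟨_, W, hx, a, rfl⟩ ⟨z, hz⟩
      obtain ⟨W', hx', b, rfl⟩ := hz
      apply Subtype.ext
      change S.germ hx a * S.germ hx' b = S.germ hx' b * S.germ hx a
      have hx₂ : x ∈ W ⊓ W' := Opens.mem_inf.2 ⟨hx, hx'⟩
      rw [← S.germ_res inf_le_left hx₂, ← S.germ_res inf_le_right hx₂, ← map_mul, ← map_mul]
      exact congrArg (S.germ hx₂) ((S.grading _).even_comm _ (S.evenRes inf_le_left a).2 _) }

/-- The germ of an even function. -/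
noncomputable def evenGerm (hx : x ∈ W) : S.evenFn W →+* S.evenStalk x :=
  ((S.germ hx).comp (S.grading W).even.subtype).codRestrict (S.evenStalk x)
    (fun a => ⟨W, hx, a, rfl⟩)

theorem evenGerm_res {W' : Opens S.X} (h : W' ≤ W) (hx : x ∈ W') (a : S.evenFn W) :
    S.evenGerm hx (S.evenRes h a) = S.evenGerm (h hx) a := Subtype.ext (S.germ_res h hx _)

theorem isUnit_evenStalk_iff {z : S.evenStalk x} : IsUnit z ↔ IsUnit (z : S.stalk x) := by
  refine ⟨fun h => h.map (S.evenStalk x).subtype, fun h => ?_⟩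
  obtain ⟨_, W, hx, a, rfl⟩ := z
  obtain ⟨W', hW, hx', ha⟩ := S.exists_isUnit_evenRes h
  have := ha.map (S.evenGerm hx')
  rwa [S.evenGerm_res] at this

instance (x : S.X) : IsLocalRing (S.evenStalk x) :=
  .of_isUnit_or_isUnit_of_isUnit_add fun a b h => by
    rw [S.isUnit_evenStalk_iff] at h ⊢
    rw [S.isUnit_evenStalk_iff]
    exact IsLocalRing.isUnit_or_isUnit_of_isUnit_add h

/-- The residue field of a point; odd functions are nilpotent, so the even stalk suffices. -/
abbrev residueField (x : S.X) : Type u := IsLocalRing.ResidueField (S.evenStalk x)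

/-- The value of an even function at a point. -/
noncomputable def eval (hx : x ∈ W) : S.evenFn W →+* S.residueField x :=
  (IsLocalRing.residue (S.evenStalk x)).comp (S.evenGerm hx)

theorem eval_res {W' : Opens S.X} (h : W' ≤ W) (hx : x ∈ W') (a : S.evenFn W) :
    S.eval hx (S.evenRes h a) = S.eval (h hx) a :=
  congrArg (IsLocalRing.residue (S.evenStalk x)) (S.evenGerm_res h hx a)

theorem eval_ne_zero_iff {hx : x ∈ W} {a : S.evenFn W} :
    S.eval hx a ≠ 0 ↔ IsUnit (S.germ hx a) := by
  change IsLocalRing.residue (S.evenStalk x) (S.evenGerm hx a) ≠ 0 ↔ _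
  rw [IsLocalRing.residue_ne_zero_iff_isUnit, S.isUnit_evenStalk_iff]
  rfl

theorem exists_isUnit_of_eval_ne_zero {hx : x ∈ W} {a : S.evenFn W} (h : S.eval hx a ≠ 0) :
    ∃ (W' : Opens S.X) (hW : W' ≤ W), x ∈ W' ∧ IsUnit (S.evenRes hW a) :=
  S.exists_isUnit_evenRes (S.eval_ne_zero_iff.1 h)

theorem exists_eval_eq (c : S.residueField x) :
    ∃ (W : Opens S.X) (hx : x ∈ W) (a : S.evenFn W), S.eval hx a = c := by
  obtain ⟨⟨_, W, hx, a, rfl⟩, rfl⟩ := IsLocalRing.residue_surjective c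
  exact ⟨W, hx, a, rfl⟩

theorem germ_mem_nonunits_of_odd (hx : x ∈ W) {a : S.fn W} (ha : a ∈ (S.grading W).odd) :
    S.germ hx a ∈ nonunits (S.stalk x) := by
  intro h
  have e : S.germ hx a * S.germ hx a = 0 := by
    rw [← map_mul, (S.grading W).odd_mul_self (S.isUnit_two W) ha, map_zero]
  have := h.mul h
  rw [e, isUnit_zero_iff] at this
  exact zero_ne_one this

theorem exists_le_of_finite {ι : Type*} [Finite ι] (W : ι → Opens S.X) (h : ∀ i, x ∈ W i) :
    ∃ W' : Opens S.X, x ∈ W' ∧ ∀ i, W' ≤ W i := by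
  cases nonempty_fintype ι
  refine ⟨Finset.univ.inf W, ?_, fun i => Finset.inf_le (Finset.mem_univ i)⟩
  rw [← SetLike.mem_coe, Opens.coe_finset_inf, Finset.inf_set_eq_iInter]
  simpa using h

theorem exists_matrix_lift {ι κ : Type*} [Finite ι] [Finite κ] (hx : x ∈ W)
    (P : Matrix ι κ (S.residueField x)) :
    ∃ (W' : Opens S.X) (_ : W' ≤ W) (hx' : x ∈ W') (Q : Matrix ι κ (S.evenFn W')),
      Q.map (S.eval hx') = P := by
  choose V hV a ha using fun ij : ι × κ => S.exists_eval_eq (P ij.1 ij.2)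
  obtain ⟨W', hx', hle⟩ := S.exists_le_of_finite V hV
  refine ⟨W ⊓ W', inf_le_left, Opens.mem_inf.2 ⟨hx, hx'⟩,
    Matrix.of fun i j => S.evenRes (inf_le_right.trans (hle (i, j))) (a (i, j)), ?_⟩
  refine Matrix.ext fun i j => ?_
  rw [Matrix.map_apply, Matrix.of_apply, S.eval_res, ha]

theorem map_eval_map_res {ι κ : Type*} {W' : Opens S.X} (h : W' ≤ W) (hx : x ∈ W')
    (D : Matrix ι κ (S.evenFn W)) :
    (D.map (S.evenRes h)).map (S.eval hx) = D.map (S.eval (h hx)) :=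
  Matrix.ext fun i j => S.eval_res h hx (D i j)

theorem exists_matrix_lift_isUnit {ι : Type*} [Fintype ι] [DecidableEq ι] (hx : x ∈ W)
    {P : Matrix ι ι (S.residueField x)} (hP : IsUnit P) :
    ∃ (W' : Opens S.X) (_ : W' ≤ W) (hx' : x ∈ W') (Q : Matrix ι ι (S.evenFn W')),
      Q.map (S.eval hx') = P ∧ IsUnit Q.det := by
  obtain ⟨W₁, h₁, hx₁, Q, rfl⟩ := S.exists_matrix_lift hx P
  have hQ : S.eval hx₁ Q.det ≠ 0 := by
    rw [RingHom.map_det]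
    exact ((isUnit_iff_isUnit_det _).1 hP).ne_zero
  obtain ⟨W', hW, hx', hu⟩ := S.exists_isUnit_of_eval_ne_zero hQ
  rw [RingHom.map_det] at hu
  exact ⟨W', hW.trans h₁, hx', Q.map (S.evenRes hW), S.map_eval_map_res hW hx' Q, hu⟩

end Superspace

namespace SuperModule

variable {S : Superspace.{u}} {V : SuperModule S} {m n : ℕ} {W : Opens S.X}

namespace Subsheaf

/-- The inclusion of a subsheaf. -/
def incl (L : V.Subsheaf) (W : Opens S.X) : L.toSuperModule.obj W →ₗ[S.fn W] V.obj W :=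
  (L.carrier W).subtype

/-- The projection to the quotient by a subsheaf. -/
def proj (L : V.Subsheaf) (W : Opens S.X) : V.obj W →ₗ[S.fn W] L.quotient.obj W :=
  (L.carrier W).mkQ

variable (L L₁ L₂ : V.Subsheaf)

theorem incl_mem (v : L.toSuperModule.obj W) : L.incl W v ∈ L.carrier W := Subtype.prop _

theorem incl_res {W' : Opens S.X} (h : W' ≤ W) (v : L.toSuperModule.obj W) :
    L.incl W' (L.toSuperModule.res h v) = V.res h (L.incl W v) := rfl

theorem proj_eq_zero_iff {v : V.obj W} : L.proj W v = 0 ↔ v ∈ L.carrier W :=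
  Submodule.Quotient.mk_eq_zero _

theorem delta_app (v : L₁.toSuperModule.obj W) :
    (L₁.delta L₂).app W le_top v = L₂.proj W (L₁.incl W v) := rfl

theorem incl_mem_homog {b : Bool} {v : L.toSuperModule.obj W}
    (h : v ∈ L.toSuperModule.homog W b) : L.incl W v ∈ V.homog W b := by
  cases b <;> exact h

theorem exists_proj_eq {b : Bool} {y : L.quotient.obj W} (h : y ∈ L.quotient.homog W b) :
    ∃ v ∈ V.homog W b, L.proj W v = y := by
  cases b <;> exact h

end Subsheaf

variable {x : S.X}

theorem germ_res {M : SuperModule S} {W' : Opens S.X} (h : W' ≤ W) (hx : x ∈ W') (v : M.obj W) :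
    M.germ hx (M.res h v) = M.germ (h hx) v := by
  classical
  exact AddCommGroup.DirectLimit.of_f (ι := {W : Opens S.X // x ∈ W}ᵒᵈ)
    (G := fun W => M.obj (OrderDual.ofDual W).1) (f := fun _ _ h => M.res h)
    (i := OrderDual.toDual ⟨W, h hx⟩) (j := OrderDual.toDual ⟨W', hx⟩) (hij := h) v

open Classical in
/-- The homomorphism `v ↦ (v, w)` on the stalk given by pairing with a section `w`. -/
noncomputable def SkewForm.stalkPairing (B : V.SkewForm) (hx : x ∈ W) (w : V.obj W) :
    V.Stalk x →+ S.stalk x :=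
  AddCommGroup.DirectLimit.lift (ι := {W : Opens S.X // x ∈ W}ᵒᵈ)
    (fun W => V.obj (OrderDual.ofDual W).1) (fun _ _ h => V.res h) (S.stalk x)
    (fun W' => (S.germ (Opens.mem_inf.2 ⟨(OrderDual.ofDual W').2, hx⟩ :
        x ∈ (OrderDual.ofDual W').1 ⊓ W)).toAddMonoidHom.comp
      (((B.form _).flip (V.res inf_le_right w)).comp (V.res inf_le_left)))
    (fun W' W'' h v => by
      have hle : (OrderDual.ofDual W'').1 ≤ (OrderDual.ofDual W').1 := h
      have h' : (OrderDual.ofDual W'').1 ⊓ W ≤ (OrderDual.ofDual W').1 ⊓ W :=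
        inf_le_inf_right W hle
      change S.germ _ (B.form _ (V.res _ (V.res hle v)) (V.res _ w)) =
        S.germ _ (B.form _ (V.res _ v) (V.res _ w))
      rw [← S.germ_res h' (Opens.mem_inf.2 ⟨(OrderDual.ofDual W'').2, hx⟩), ← B.form_res,
        V.res_res, V.res_res, V.res_res])

theorem SkewForm.stalkPairing_germ (B : V.SkewForm) (hx : x ∈ W) (w : V.obj W) {W' : Opens S.X}
    (hx' : x ∈ W') (v : V.obj W') : B.stalkPairing hx w (V.germ hx' v) =
      S.germ (Opens.mem_inf.2 ⟨hx', hx⟩)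
        (B.form (W' ⊓ W) (V.res inf_le_left v) (V.res inf_le_right w)) := by
  classical
  exact AddCommGroup.DirectLimit.lift_of _ _ _ _ _

theorem SkewForm.germ_form_mem_nonunits (B : V.SkewForm) (hx : x ∈ W) {v : V.obj W}
    (hv : V.value hx v = 0) (w : V.obj W) : S.germ hx (B.form W v w) ∈ nonunits (S.stalk x) := by
  have hv' : V.germ hx v ∈ V.maximalIdealSMul x := (QuotientAddGroup.eq_zero_iff _).1 hv
  have key : ∀ ξ ∈ V.maximalIdealSMul x, B.stalkPairing hx w ξ ∈ nonunits (S.stalk x) := by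
    intro ξ hξ
    induction hξ using AddSubgroup.closure_induction with
    | mem ξ h =>
      obtain ⟨W', hx', a, v', ha, rfl⟩ := h
      rw [B.stalkPairing_germ, V.res_smul, B.smul_left, map_mul, S.germ_res]
      exact mul_mem_nonunits_of_isLocalRing ha _
    | zero =>
      rw [map_zero]
      exact zero_mem_nonunits.2 zero_ne_one
    | add ξ ξ' _ _ h h' =>
      rw [map_add]
      exact IsLocalRing.nonunits_add h h'
    | neg ξ _ h =>
      rw [map_neg]
      intro hu
      exact h ((IsUnit.neg_iff _).1 hu)
  have := key _ hv'
  rwa [B.stalkPairing_germ, B.form_res, S.germ_res] at this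

/-- A coordinate of a frame, as a functional. -/
noncomputable def Frame.coordFunctional {M : SuperModule S} (e : M.Frame m n W)
    (i : Fin m ⊕ Fin n) : Functional W M where
  app W' h :=
    { toFun := fun v => (e.restrict h).basis.repr v i
      map_add' := fun v v' => by rw [map_add, Finsupp.add_apply]
      map_smul' := fun a v => by rw [map_smul, Finsupp.smul_apply]; rfl }
  app_res W' W'' h h' v := by
    simp only [LinearMap.coe_mk, AddHom.coe_mk, ← e.restrict_restrict h h', Frame.repr_restrict]

theorem SkewForm.exists_dual_section {B : V.SkewForm} {L : V.Subsheaf} (hL : B.SurjectsOntoDual L)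
    (e : L.toSuperModule.Frame m n W) (hx : x ∈ W) (i : Fin m ⊕ Fin n) :
    ∃ (W' : Opens S.X) (h : W' ≤ W) (w : V.obj W'), x ∈ W' ∧
      ∀ (W'' : Opens S.X) (h' : W'' ≤ W') (l : L.toSuperModule.obj W''),
        B.form W'' (L.incl W'' l) (V.res h' w) = (e.restrict (h'.trans h)).basis.repr l i := by
  obtain ⟨W', h, w, hx', hw⟩ := hL W (e.coordFunctional i) x hx
  exact ⟨W', h, w, hx', fun W'' h' l => (hw W'' h' l).symm⟩

theorem Frame.exists_lift {L : V.Subsheaf} (g : L.quotient.Frame m n W) :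
    ∃ v : Fin m ⊕ Fin n → V.obj W, (∀ j, v j ∈ V.homog W j.isRight) ∧
      ∀ j, L.proj W (v j) = g.vec j := by
  choose v hv h using fun j => L.exists_proj_eq (g.vec_mem_homog j)
  exact ⟨v, hv, h⟩

section Fibre

open Matrix

variable {B : V.SkewForm} {L L₁ L₂ : V.Subsheaf}

theorem germ_repr_mem_nonunits (hdual : B.SurjectsOntoDual L) (hx : x ∈ W)
    (e : L.toSuperModule.Frame m n W) {l : L.toSuperModule.obj W}
    (hl : V.value hx (L.incl W l) = 0) (i : Fin m ⊕ Fin n) :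
    S.germ hx (e.basis.repr l i) ∈ nonunits (S.stalk x) := by
  obtain ⟨W', h, w, hx', hw⟩ := SkewForm.exists_dual_section hdual e hx i
  have hl' : V.value hx' (V.res h (L.incl W l)) = 0 := by
    rw [← hl]
    exact congrArg QuotientAddGroup.mk (germ_res h hx' _)
  have hnu := B.germ_form_mem_nonunits hx' hl' w
  have hform := hw W' le_rfl (L.toSuperModule.res h l)
  rw [V.res_self, L.incl_res, e.repr_restrict] at hform
  rwa [hform, S.germ_res] at hnu

theorem value_sub_sum_smul {ι : Type*} [Fintype ι] (hx : x ∈ W) {q : ι → S.fn W}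
    (hq : ∀ j, S.germ hx (q j) ∈ nonunits (S.stalk x)) (v : V.obj W) (u : ι → V.obj W) :
    V.value hx (v - ∑ j, q j • u j) = V.value hx v := by
  refine (QuotientAddGroup.eq).2 ?_
  rw [map_sub, neg_sub, sub_add_cancel, map_sum]
  exact sum_mem fun j _ => AddSubgroup.subset_closure ⟨W, hx, q j, u j, hq j, rfl⟩

theorem value_eq_zero_of_delta_eq (hs : L₁.fibreEven x ∩ L₂.fibreEven x = {0}) (hx : x ∈ W)
    (g : L₂.quotient.Frame m n W) {l : L₁.toSuperModule.obj W}
    (hl : l ∈ L₁.toSuperModule.homog W false) {q : Fin m ⊕ Fin n → S.fn W}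
    (hδ : (L₁.delta L₂).app W le_top l = ∑ j, q j • g.vec j)
    (hq : ∀ j, S.germ hx (q j) ∈ nonunits (S.stalk x)) : V.value hx (L₁.incl W l) = 0 := by
  obtain ⟨u, hu, hproj⟩ := g.exists_lift
  have hqhom : ∀ j, q j ∈ (S.grading W).homog (false ^^ j.isRight) := fun j => by
    have := g.repr_mem_homog ((L₁.delta L₂).app_mem_homog le_top hl) j
    rwa [hδ, g.repr_sum] at this
  have hmem : L₁.incl W l - ∑ j, q j • u j ∈ L₂.carrier W := by
    rw [← L₂.proj_eq_zero_iff, map_sub, ← Subsheaf.delta_app, hδ, map_sum]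
    simp only [map_smul, hproj, sub_self]
  have : V.value hx (L₁.incl W l) ∈ L₁.fibreEven x ∩ L₂.fibreEven x :=
    ⟨⟨W, hx, _, L₁.incl_mem l, L₁.incl_mem_homog hl, rfl⟩,
      ⟨W, hx, _, hmem, sub_mem (L₁.incl_mem_homog hl) (sum_smul_mem_homog hqhom hu),
        (value_sub_sum_smul hx hq _ u).symm⟩⟩
  rwa [hs] at this

variable {A : Matrix (Fin m) (Fin m) (S.evenFn W)} {B₁ : Matrix (Fin m) (Fin n) (S.fn W)}
  {C : Matrix (Fin n) (Fin m) (S.fn W)} {D : Matrix (Fin n) (Fin n) (S.fn W)}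

theorem eval_eq_zero_of_vecMul (hdual : B.SurjectsOntoDual L₁)
    (hs : L₁.fibreEven x ∩ L₂.fibreEven x = {0}) (hx : x ∈ W)
    {e : L₁.toSuperModule.Frame m n W} {g : L₂.quotient.Frame m n W}
    (hB₁ : (S.grading W).IsOddMatrix B₁)
    (hN : (L₁.delta L₂).matrix e g = fromBlocks ((S.grading W).coeMatrix A) B₁ C D)
    {c : Fin m → S.evenFn W} (hc : ∀ j, S.eval hx ((c ᵥ* A) j) = 0) (i : Fin m) :
    S.eval hx (c i) = 0 := by
  let a : Fin m ⊕ Fin n → S.fn W := Sum.elim (fun i => (c i : S.fn W)) 0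
  have ha : ∀ k, a k ∈ (S.grading W).homog (false ^^ k.isRight) := by
    rintro (k | k)
    exacts [(c k).2, zero_mem _]
  have hq : ∀ j, S.germ hx ((a ᵥ* (L₁.delta L₂).matrix e g) j) ∈ nonunits (S.stalk x) := by
    rw [hN, vecMul_fromBlocks]
    rintro (j | j)
    · have hj : (a ∘ Sum.inl ᵥ* (S.grading W).coeMatrix A + a ∘ Sum.inr ᵥ* C) j =
          ((c ᵥ* A) j : S.fn W) := by
        rw [Pi.add_apply, show a ∘ Sum.inr = 0 from rfl, zero_vecMul, Pi.zero_apply, add_zero]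
        exact ((S.grading W).even.subtype.map_vecMul A c j).symm
      rw [Sum.elim_inl, hj]
      exact fun hu => S.eval_ne_zero_iff.2 hu (hc j)
    · rw [Sum.elim_inr, show a ∘ Sum.inr = 0 from rfl, zero_vecMul, add_zero]
      refine S.germ_mem_nonunits_of_odd hx ?_
      rw [vecMul, dotProduct]
      exact sum_mem fun i _ => (S.grading W).even_mul_odd _ (c i).2 _ (hB₁ i j)
  have hl := value_eq_zero_of_delta_eq hs hx g (sum_smul_mem_homog ha e.vec_mem_homog)
    ((L₁.delta L₂).app_sum_smul e g a) hq
  have hi := germ_repr_mem_nonunits hdual hx e hl (Sum.inl i)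
  rw [e.repr_sum] at hi
  by_contra hne
  exact hi (S.eval_ne_zero_iff.1 hne)

theorem eval_det_ne_zero (hdual : B.SurjectsOntoDual L₁)
    (hs : L₁.fibreEven x ∩ L₂.fibreEven x = {0}) (hx : x ∈ W)
    {e : L₁.toSuperModule.Frame m n W} {g : L₂.quotient.Frame m n W}
    (hB₁ : (S.grading W).IsOddMatrix B₁)
    (hN : (L₁.delta L₂).matrix e g = fromBlocks ((S.grading W).coeMatrix A) B₁ C D) :
    S.eval hx A.det ≠ 0 := by
  intro h0
  rw [RingHom.map_det] at h0
  obtain ⟨c, hc, hcA⟩ := Matrix.exists_vecMul_eq_zero_iff.2 h0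
  obtain ⟨W', h, hx', Q, hQ⟩ := S.exists_matrix_lift hx (Matrix.replicateRow Unit c)
  have hQ' : ∀ i, S.eval hx' (Q () i) = c i := fun i => congrFun (congrFun hQ ()) i
  refine hc (funext fun i => ?_)
  rw [← hQ' i]
  have hN' : (L₁.delta L₂).matrix (e.restrict h) (g.restrict h) = fromBlocks
      ((S.grading W').coeMatrix (A.map (S.evenRes h))) (B₁.map (S.res h)) (C.map (S.res h))
      (D.map (S.res h)) := by
    rw [HomOver.matrix_restrict, hN, fromBlocks_map]
    rfl
  refine eval_eq_zero_of_vecMul hdual hs hx' (Superspace.isOddMatrix_map_res h hB₁) hN'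
    (fun j => ?_) i
  rw [RingHom.map_vecMul, S.map_eval_map_res]
  exact (congrArg (fun c => (c ᵥ* A.map (S.eval (h hx'))) j) (funext hQ')).trans (congrFun hcA j)

end Fibre

end SuperModule

section ExtendByOne

open Matrix

variable {ι R : Type*} [Fintype ι] [DecidableEq ι] [CommRing R]

theorem extendByOne_submatrix_one_sub (p : ι → Prop) [DecidablePred p] (S : Matrix ι ι R) :
    extendByOne p ((1 - S).submatrix Subtype.val Subtype.val) =
      1 - diagonal (fun i => if p i then 1 else 0) * S *
        diagonal fun i => if p i then 1 else 0 := by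
  ext i j
  rw [extendByOne, reindex_apply, submatrix_apply]
  by_cases hi : p i <;> by_cases hj : p j <;> rcases eq_or_ne i j with rfl | hij <;>
    simp_all [one_apply, Equiv.sumCompl_symm_apply_of_pos, Equiv.sumCompl_symm_apply_of_neg]

end ExtendByOne

namespace SuperGrading

open Matrix

variable {R : Type u} [Ring R] {σ : SuperGrading R}

theorem map_eq_map_of_coeMatrix_eq_add {ι κ : Type*} [Fintype ι] [DecidableEq ι] [Fintype κ]
    (h2 : IsUnit (2 : σ.even)) {B : Matrix ι κ R} {C : Matrix κ ι R} (hB : σ.IsOddMatrix B)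
    (hC : σ.IsOddMatrix C) {A T : Matrix ι ι σ.even}
    (h : σ.coeMatrix T = σ.coeMatrix A + B * C) {K : Type*} [CommRing K] [IsReduced K]
    (φ : σ.even →+* K) : T.map φ = A.map φ := by
  ext i j
  rw [map_apply, map_apply, ← sub_eq_zero, ← map_sub]
  exact ((mem_nilradical.1 (sub_mem_nilradical_of_coeMatrix_eq_add h2 hB hC h i j)).map φ).eq_zero

variable {m n : ℕ} {M N : Matrix (Fin m ⊕ Fin n) (Fin m ⊕ Fin n) R}

theorem isEvenMatrix_one : σ.IsEvenMatrix (1 : Matrix (Fin m ⊕ Fin n) (Fin m ⊕ Fin n) R) := by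
  rw [← fromBlocks_one, ← map_one σ.coeMatrix, ← map_one σ.coeMatrix]
  exact isEvenMatrix_fromBlocks isOddMatrix_zero isOddMatrix_zero

theorem IsEvenMatrix.add (hM : σ.IsEvenMatrix M) (hN : σ.IsEvenMatrix N) :
    σ.IsEvenMatrix (M + N) := fun i j => add_mem (hM i j) (hN i j)

theorem IsEvenMatrix.sub (hM : σ.IsEvenMatrix M) (hN : σ.IsEvenMatrix N) :
    σ.IsEvenMatrix (M - N) := fun i j => sub_mem (hM i j) (hN i j)

theorem isEvenUnit_one_add_mul_one_sub (hM : σ.IsEvenMatrix M) (hMM : M * M = M)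
    (hN : σ.IsEvenMatrix N) : σ.IsEvenUnit (1 + M * N * (1 - M)) :=
  have h := (hM.mul hN).mul (isEvenMatrix_one.sub hM)
  ⟨isEvenMatrix_one.add h, _, isEvenMatrix_one.sub h, one_add_mul_one_sub_cancel hMM N,
    one_sub_mul_one_add_cancel hMM N⟩

variable {A : Matrix (Fin m) (Fin m) σ.even} {B : Matrix (Fin m) (Fin n) R}
  {C : Matrix (Fin n) (Fin m) R} {D : Matrix (Fin n) (Fin n) σ.even}

/-- Adding the idempotent of the block `p` makes the supermatrix invertible, and removing it again
only affects that block. -/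
theorem exists_mul_mul_eq_extendByOne (h2 : IsUnit (2 : σ.even)) (hB : σ.IsOddMatrix B)
    (hC : σ.IsOddMatrix C) (hA : IsUnit A.det) (p : Fin n → Prop) [DecidablePred p]
    (hD : IsUnit (D + diagonal fun i => if p i then 1 else 0).det) {K : Type*} [CommRing K]
    [IsReduced K] {φ : σ.even →+* K}
    (hφ : (D + diagonal fun i => if p i then 1 else 0).map φ = 1) :
    ∃ (P Q : Matrix (Fin m ⊕ Fin n) (Fin m ⊕ Fin n) R)
      (X : Matrix {i // p i} {i // p i} σ.even),
      σ.IsEvenUnit P ∧ σ.IsEvenUnit Q ∧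
      P * fromBlocks (σ.coeMatrix A) B C (σ.coeMatrix D) * Q =
        fromBlocks 1 0 0 (σ.coeMatrix (extendByOne p X)) ∧ X.map φ = 0 := by
  set E : Matrix (Fin n) (Fin n) σ.even := diagonal fun i => if p i then 1 else 0
  set t := fromBlocks (σ.coeMatrix A) B C (σ.coeMatrix (D + E))
  set ε : Matrix (Fin m ⊕ Fin n) (Fin m ⊕ Fin n) R := fromBlocks 0 0 0 (σ.coeMatrix E)
  have hε : σ.IsEvenMatrix ε := by
    change σ.IsEvenMatrix (fromBlocks 0 0 0 (σ.coeMatrix E))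
    rw [← map_zero σ.coeMatrix]
    exact isEvenMatrix_fromBlocks isOddMatrix_zero isOddMatrix_zero
  have hE : E * E = E := by simp [E, diagonal_mul_diagonal, ← ite_and]
  have hεε : ε * ε = ε := by simp [ε, fromBlocks_multiply, ← map_mul, hE]
  obtain ⟨ht, s, hs, hts, hst⟩ := isEvenUnit_fromBlocks h2 hB hC hA hD
  have hN : fromBlocks (σ.coeMatrix A) B C (σ.coeMatrix D) = t - ε := by
    rw [eq_sub_iff_add_eq, fromBlocks_add, add_zero, add_zero, add_zero, ← map_add]
  refine ⟨1 + ε * s * (1 - ε), s, ?_⟩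
  obtain ⟨A', B', C', S, hB', -, rfl⟩ := hs.exists_fromBlocks
  refine ⟨(1 - S).submatrix Subtype.val Subtype.val, isEvenUnit_one_add_mul_one_sub hε hεε hs,
    ⟨hs, t, ht, hst, hts⟩, ?_, ?_⟩
  · have hX : extendByOne p ((1 - S).submatrix Subtype.val Subtype.val) = 1 - E * S * E :=
      extendByOne_submatrix_one_sub p S
    rw [hN, Matrix.mul_assoc, one_add_mul_sub_mul_mul hεε hts, hX,
      sub_eq_iff_eq_add, map_sub, map_mul, map_mul, map_one]
    simp only [ε, fromBlocks_multiply, fromBlocks_add, Matrix.zero_mul, Matrix.mul_zero, add_zero,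
      zero_add, sub_add_cancel, fromBlocks_one]
  · rw [fromBlocks_multiply, ← fromBlocks_one, fromBlocks_inj] at hts
    have hS : ((D + E) * S).map φ = (1 : Matrix _ _ σ.even).map φ :=
      map_eq_map_of_coeMatrix_eq_add h2 hC.neg hB' (by
        rw [map_mul, map_one, ← hts.2.2.2, Matrix.neg_mul, add_neg_cancel_comm]) φ
    rw [Matrix.map_mul, hφ, Matrix.one_mul] at hS
    ext i j
    rw [map_apply, submatrix_apply, Matrix.sub_apply, map_sub, Matrix.zero_apply, sub_eq_zero]
    exact (congrFun (congrFun hS i) j).symm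

end SuperGrading

section RankNormalForm

open Matrix

theorem exists_mul_mul_add_diagonal_eq_one {ι K : Type*} [Fintype ι] [DecidableEq ι] [Field K]
    (M : Matrix ι ι K) :
    ∃ (P Q : Matrix ι ι K) (p : ι → Prop) (_ : DecidablePred p), IsUnit P ∧ IsUnit Q ∧
      P * M * Q + diagonal (fun i => if p i then 1 else 0) = 1 := by
  obtain ⟨P, Q, e, hP, hQ, h⟩ := M.exists_rank_normal_form
  refine ⟨P, Q, fun i => (e i).isRight, inferInstance, hP, hQ, ?_⟩
  have hdiag : diagonal (fun i => if (e i).isRight then (1 : K) else 0) =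
      (fromBlocks 0 0 0 1).submatrix e e := by
    rw [← diagonal_zero, ← diagonal_one, fromBlocks_diagonal, submatrix_diagonal _ _ e.injective]
    congr 1
    ext i
    rcases hi : e i <;> simp [hi]
  rw [h, hdiag]
  change (fromBlocks 1 0 0 0 + fromBlocks 0 0 0 1 : Matrix _ _ K).submatrix e e = 1
  rw [fromBlocks_add, add_zero, add_zero, add_zero, zero_add, fromBlocks_one, submatrix_one_equiv]

end RankNormalForm

namespace SuperModule

open Matrix

variable {S : Superspace.{u}} {m n : ℕ} {W : Opens S.X}

section NormalForm

variable {E F : SuperModule S}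

theorem HomOver.exists_frames_matrix_eq_mul (d : HomOver ⊤ E F) (e : E.Frame m n W)
    (g : F.Frame m n W) {P Q : Matrix (Fin m ⊕ Fin n) (Fin m ⊕ Fin n) (S.fn W)}
    (hP : (S.grading W).IsEvenUnit P) (hQ : (S.grading W).IsEvenUnit Q) :
    ∃ (e' : E.Frame m n W) (g' : F.Frame m n W), d.matrix e' g' = P * d.matrix e g * Q := by
  obtain ⟨hQe, Q', hQ', hQQ', hQ'Q⟩ := hQ
  have hQ'u : (S.grading W).IsEvenUnit Q' := ⟨hQ', Q, hQe, hQ'Q, hQQ'⟩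
  exact ⟨e.change P hP, g.change Q' hQ'u, by
    rw [d.matrix_change e _ g, Frame.coords_change, Frame.change_coords _ _ hQ'Q]⟩

theorem HomOver.exists_frames_map_eval_add_diagonal_eq_one (d : HomOver ⊤ E F) {x : S.X}
    (hx : x ∈ W) (e : E.Frame m n W) (g : F.Frame m n W) :
    ∃ (W' : Opens S.X) (_ : W' ≤ W) (hx' : x ∈ W') (e' : E.Frame m n W') (g' : F.Frame m n W')
      (A : Matrix (Fin m) (Fin m) (S.evenFn W')) (B : Matrix (Fin m) (Fin n) (S.fn W'))
      (C : Matrix (Fin n) (Fin m) (S.fn W')) (D : Matrix (Fin n) (Fin n) (S.evenFn W'))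
      (p : Fin n → Prop) (_ : DecidablePred p),
      (S.grading W').IsOddMatrix B ∧ (S.grading W').IsOddMatrix C ∧
      d.matrix e' g' =
        fromBlocks ((S.grading W').coeMatrix A) B C ((S.grading W').coeMatrix D) ∧
      (D + diagonal fun i => if p i then 1 else 0).map (S.eval hx') = 1 := by
  obtain ⟨A, B, C, D, hB, hC, hN⟩ := (d.isEvenMatrix_matrix e g).exists_fromBlocks
  obtain ⟨P₀, Q₀, p, hp, hP₀, hQ₀, h⟩ := exists_mul_mul_add_diagonal_eq_one (D.map (S.eval hx))
  obtain ⟨W₁, h₁, hx₁, P, rfl, hP⟩ := S.exists_matrix_lift_isUnit hx hP₀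
  obtain ⟨W₂, h₂, hx₂, Q, rfl, hQ⟩ := S.exists_matrix_lift_isUnit hx₁ hQ₀
  have hle : W₂ ≤ W := h₂.trans h₁
  let σ := S.grading W₂
  let P' := (S.evenRes h₂).mapMatrix P
  have hP' : IsUnit P'.det := by
    rw [← RingHom.map_det]
    exact hP.map (S.evenRes h₂)
  obtain ⟨e', g', hN'⟩ := d.exists_frames_matrix_eq_mul (e.restrict hle) (g.restrict hle)
    (SuperGrading.isEvenUnit_diag (σ := σ) (A := (1 : Matrix (Fin m) (Fin m) _)) (by simp) hP')
    (SuperGrading.isEvenUnit_diag (σ := σ) (A := (1 : Matrix (Fin m) (Fin m) _)) (by simp) hQ)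
  refine ⟨W₂, hle, hx₂, e', g', (S.evenRes hle).mapMatrix A, B.map (S.res hle) * σ.coeMatrix Q,
    σ.coeMatrix P' * C.map (S.res hle), P' * (S.evenRes hle).mapMatrix D * Q, p, hp,
    (S.isOddMatrix_map_res hle hB).mul_coeMatrix _, (S.isOddMatrix_map_res hle hC).coeMatrix_mul _,
    ?_, ?_⟩
  · rw [hN', d.matrix_restrict, hN, Superspace.fromBlocks_map_res]
    simp only [fromBlocks_multiply, map_one, map_mul, Matrix.one_mul, Matrix.mul_one,
      Matrix.zero_mul, Matrix.mul_zero, add_zero, zero_add, σ]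
  · have hP'P : P'.map (S.eval hx₂) = P.map (S.eval hx₁) := S.map_eval_map_res h₂ hx₂ P
    rw [Matrix.map_add _ (map_add _), Matrix.map_mul, Matrix.map_mul, RingHom.mapMatrix_apply, hP'P,
      S.map_eval_map_res, diagonal_map (map_zero _), ← h]
    simp only [apply_ite (S.eval hx₂), map_one, map_zero]

end NormalForm

theorem SkewForm.exists_frames_matrix_delta_eq_extendByOne {V : SuperModule S} {B : V.SkewForm}
    {L₁ L₂ : V.Subsheaf} {x : S.X} (hdual : B.SurjectsOntoDual L₁)
    (hs : L₁.fibreEven x ∩ L₂.fibreEven x = {0}) (hx : x ∈ W)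
    (e : L₁.toSuperModule.Frame m n W) (g : L₂.quotient.Frame m n W) :
    ∃ (W' : Opens S.X) (_ : W' ≤ W) (hx' : x ∈ W') (e' : L₁.toSuperModule.Frame m n W')
      (g' : L₂.quotient.Frame m n W') (p : Fin n → Prop) (_ : DecidablePred p)
      (X : Matrix {i // p i} {i // p i} (S.evenFn W')),
      (L₁.delta L₂).matrix e' g' =
        fromBlocks 1 0 0 ((S.grading W').coeMatrix (extendByOne p X)) ∧
      X.map (S.eval hx') = 0 := by
  obtain ⟨W₁, h₁, hx₁, e₁, g₁, A, B₁, C, D, p, hp, hB, hC, hN, hD⟩ :=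
    (L₁.delta L₂).exists_frames_map_eval_add_diagonal_eq_one hx e g
  set D' := D + diagonal fun i => if p i then 1 else 0
  have hAD : S.eval hx₁ (A.det * D'.det) ≠ 0 := by
    rw [map_mul, RingHom.map_det _ D', RingHom.mapMatrix_apply, hD, det_one, mul_one]
    exact eval_det_ne_zero hdual hs hx₁ hB hN
  obtain ⟨W', h, hx', hu⟩ := S.exists_isUnit_of_eval_ne_zero hAD
  rw [map_mul, IsUnit.mul_iff, RingHom.map_det, RingHom.map_det] at hu
  have hD' : (S.evenRes h).mapMatrix D' =
      (S.evenRes h).mapMatrix D + diagonal fun i => if p i then 1 else 0 := by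
    rw [map_add, RingHom.mapMatrix_apply _ (diagonal _), diagonal_map (map_zero _)]
    simp only [apply_ite (S.evenRes h), map_one, map_zero]
  obtain ⟨P, Q, X, hP, hQ, hX, hX₀⟩ := SuperGrading.exists_mul_mul_eq_extendByOne (S.isUnit_two W')
    (S.isOddMatrix_map_res h hB) (S.isOddMatrix_map_res h hC) hu.1 p (hD' ▸ hu.2)
    (φ := S.eval hx') (by rw [← hD', RingHom.mapMatrix_apply, S.map_eval_map_res, hD])
  obtain ⟨e', g', hN'⟩ := (L₁.delta L₂).exists_frames_matrix_eq_mul (e₁.restrict h) (g₁.restrict h)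
    hP hQ
  refine ⟨W', h.trans h₁, hx', e', g', p, hp, X, ?_, hX₀⟩
  rw [hN', HomOver.matrix_restrict, hN, Superspace.fromBlocks_map_res, hX]

end SuperModule

namespace SuperModule

open Matrix

variable {S : Superspace.{u}} {V : SuperModule S} {m n : ℕ} {W : Opens S.X}

/-- The odd sections over `W`, as a module over the even functions. -/
def oddSections (V : SuperModule S) (W : Opens S.X) : Submodule (S.evenFn W) (V.obj W) where
  carrier := V.odd W
  add_mem' := add_mem
  zero_mem' := zero_mem _
  smul_mem' a v hv := V.even_smul_odd W a a.2 v hv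

namespace Subsheaf

/-- The odd sections of a subsheaf of `V`, as a submodule of the odd sections of `V`. -/
def oddSections (L : V.Subsheaf) (W : Opens S.X) : Submodule (S.evenFn W) (V.oddSections W) :=
  ((L.carrier W).restrictScalars (S.evenFn W)).comap (V.oddSections W).subtype

/-- The odd vectors of a frame of a subsheaf of `V`, as odd sections of `V`. -/
def oddVec (L : V.Subsheaf) (e : L.toSuperModule.Frame m n W) (i : Fin n) : V.oddSections W :=
  ⟨L.incl W (e.vec (Sum.inr i)), L.incl_mem_homog (e.vec_mem_homog (Sum.inr i))⟩

end Subsheaf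

namespace SkewForm

variable (B : V.SkewForm)

/-- The restriction of the form to odd sections, a symmetric bilinear form over the even
functions. -/
def oddForm (W : Opens S.X) : LinearMap.BilinForm (S.evenFn W) (V.oddSections W) :=
  LinearMap.mk₂ (S.evenFn W) (fun v w => ⟨B.form W v w, B.odd_odd W v v.2 w w.2⟩)
    (fun v v' w => Subtype.ext (by simp))
    (fun a v w => Subtype.ext (B.smul_left W a v w))
    (fun v w w' => Subtype.ext (by simp))
    (fun a v w => Subtype.ext <| by
      change B.form W v (a • w : V.oddSections W) = a * B.form W v w
      rw [B.symm_odd W v v.2 _ (a • w).2, B.symm_odd W v v.2 w w.2]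
      exact B.smul_left W a w v)

theorem oddForm_comm (v w : V.oddSections W) : B.oddForm W v w = B.oddForm W w v :=
  Subtype.ext (B.symm_odd W v v.2 w w.2)

/-- The form vanishes on the subsheaf `L`. -/
def IsIsotropic (L : V.Subsheaf) : Prop :=
  ∀ W, ∀ l ∈ L.carrier W, ∀ l' ∈ L.carrier W, B.form W l l' = 0

variable {B} {L L₁ L₂ : V.Subsheaf}

theorem IsIsotropic.oddForm_eq_zero (h : B.IsIsotropic L) :
    ∀ v ∈ L.oddSections W, ∀ w ∈ L.oddSections W, B.oddForm W v w = 0 :=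
  fun v hv w hw => Subtype.ext (h W v hv w hw)

theorem exists_odd_form_eq (w : V.obj W) :
    ∃ w₁ ∈ V.odd W, ∀ v ∈ V.odd W, B.form W v w ∈ (S.grading W).even →
      B.form W v w₁ = B.form W v w := by
  obtain ⟨w₀, h₀, w₁, h₁, rfl⟩ := exists_even_add_odd w
  refine ⟨w₁, h₁, fun v hv h => ?_⟩
  have hodd : B.form W v w₀ ∈ (S.grading W).odd := by
    rw [← neg_eq_iff_eq_neg.2 (B.skew_even W w₀ h₀ v)]
    exact neg_mem (B.even_odd W w₀ h₀ v hv)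
  rw [map_add] at h ⊢
  have heven : B.form W v w₀ ∈ (S.grading W).even :=
    (add_mem_cancel_right (B.odd_odd W v hv w₁ h₁)).1 h
  rw [(S.grading W).eq_zero_of_mem_even_of_mem_odd heven hodd, zero_add]

theorem exists_dual_sections {x : S.X} (hdual : B.SurjectsOntoDual L) (hx : x ∈ W)
    (e : L.toSuperModule.Frame m n W) :
    ∃ (W' : Opens S.X) (h : W' ≤ W) (w : Fin n → V.oddSections W'), x ∈ W' ∧
      pairingMatrix (B.oddForm W') (L.oddVec (e.restrict h)) w = 1 := by
  choose U hU w hxU hw using fun j : Fin n => exists_dual_section hdual e hx (Sum.inr j)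
  obtain ⟨W₁, hx₁, hle⟩ := S.exists_le_of_finite U hxU
  have hW (j : Fin n) : W ⊓ W₁ ≤ U j := inf_le_right.trans (hle j)
  choose w' hw' hform using fun j => B.exists_odd_form_eq (V.res (hW j) (w j))
  refine ⟨W ⊓ W₁, inf_le_left, fun j => ⟨w' j, hw' j⟩, ⟨hx, hx₁⟩, ?_⟩
  ext i j
  set v := L.oddVec (e.restrict (inf_le_left : W ⊓ W₁ ≤ W)) i
  have hv : B.form (W ⊓ W₁) v (V.res (hW j) (w j)) =
      ((1 : Matrix (Fin n) (Fin n) (S.evenFn (W ⊓ W₁))) i j : S.fn (W ⊓ W₁)) := by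
    rw [show (v : V.obj (W ⊓ W₁)) = L.incl _ _ from rfl, hw j _ (hW j), ← Frame.basis_apply,
      Module.Basis.repr_self, Finsupp.single_apply, Matrix.one_apply]
    simp only [Sum.inr.injEq]
    split_ifs <;> rfl
  change B.form (W ⊓ W₁) v (w' j) = _
  rw [hform j v v.2 (hv ▸ Subtype.prop _), hv]

end SkewForm

section AdaptedFrames

variable {E F : SuperModule S} {d : HomOver ⊤ E F} {e : E.Frame m n W} {g : F.Frame m n W}
  {D : Matrix (Fin n) (Fin n) (S.evenFn W)}

theorem HomOver.app_vec_inl (h : d.matrix e g = fromBlocks 1 0 0 ((S.grading W).coeMatrix D))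
    (i : Fin m) : d.app W le_top (e.vec (Sum.inl i)) = g.vec (Sum.inl i) := by
  rw [← d.sum_matrix e g, h, Fintype.sum_sum_type]
  simp [sum_one_smul]

theorem HomOver.app_vec_inr (h : d.matrix e g = fromBlocks 1 0 0 ((S.grading W).coeMatrix D))
    (i : Fin n) : d.app W le_top (e.vec (Sum.inr i)) = ∑ j, D i j • g.vec (Sum.inr j) := by
  rw [← d.sum_matrix e g, h, Fintype.sum_sum_type]
  simp only [fromBlocks_apply₂₁, fromBlocks_apply₂₂, Matrix.zero_apply, zero_smul,
    Finset.sum_const_zero, zero_add]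
  rfl

variable {p : Fin n → Prop} [DecidablePred p] {X : Matrix {i // p i} {i // p i} (S.evenFn W)}

theorem HomOver.exists_app_add_sum_eq
    (hX : d.matrix e g = fromBlocks 1 0 0 ((S.grading W).coeMatrix (extendByOne p X)))
    {y : F.obj W} (hy : y ∈ F.homog W true) :
    ∃ l ∈ E.homog W true, ∃ b : {i // p i} → S.evenFn W,
      y = d.app W le_top l + ∑ a, b a • g.vec (Sum.inr a) := by
  have hc := g.repr_mem_homog hy
  refine ⟨∑ k, g.basis.repr y (Sum.inl k) • e.vec (Sum.inl k) +
    ∑ k : {i // ¬p i}, g.basis.repr y (Sum.inr k) • e.vec (Sum.inr k), add_mem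
      (sum_smul_mem_homog (fun k => hc (Sum.inl k)) fun k => e.vec_mem_homog (Sum.inl k))
      (sum_smul_mem_homog (fun k => hc (Sum.inr k)) fun k => e.vec_mem_homog (Sum.inr k)),
    fun a => ⟨g.basis.repr y (Sum.inr a), hc (Sum.inr a)⟩, ?_⟩
  have hinr (k : {i // ¬p i}) : d.app W le_top (e.vec (Sum.inr k)) = g.vec (Sum.inr k) := by
    rw [HomOver.app_vec_inr hX, sum_extendByOne_smul_of_neg X _ k.2]
  have hsum := g.sum_repr y
  rw [Fintype.sum_sum_type, ← Fintype.sum_subtype_add_sum_subtype p,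
    add_comm (∑ k : {i // p i}, _), ← add_assoc] at hsum
  simp only [map_add, map_sum, map_smul, HomOver.app_vec_inl hX, hinr]
  exact hsum.symm

variable {L₁ L₂ : V.Subsheaf} {e : L₁.toSuperModule.Frame m n W} {g : L₂.quotient.Frame m n W}
  {v : Fin n → V.oddSections W}

theorem oddVec_sub_sum_mem
    (hX : (L₁.delta L₂).matrix e g =
      fromBlocks 1 0 0 ((S.grading W).coeMatrix (extendByOne p X)))
    (hv : ∀ j, L₂.proj W (v j) = g.vec (Sum.inr j)) (i : {i // p i}) :
    L₁.oddVec e i - ∑ a, X i a • v a ∈ L₂.oddSections W := by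
  have h := HomOver.app_vec_inr hX i
  rw [sum_extendByOne_smul_of_pos X (fun j => g.vec (Sum.inr j)) i] at h
  change ((L₁.oddVec e i - ∑ a, X i a • v a : V.oddSections W) : V.obj W) ∈ L₂.carrier W
  rw [← L₂.proj_eq_zero_iff, AddSubgroupClass.coe_sub, AddSubmonoidClass.coe_finsetSum, map_sub,
    map_sum, sub_eq_zero]
  refine h.trans (Finset.sum_congr rfl fun a _ => ?_)
  rw [← hv]
  exact ((L₂.proj W).map_smul (X i a : S.fn W) (v a)).symm

theorem oddSections_sup_span_sup_oddSections_eq_top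
    (hX : (L₁.delta L₂).matrix e g =
      fromBlocks 1 0 0 ((S.grading W).coeMatrix (extendByOne p X)))
    (hv : ∀ j, L₂.proj W (v j) = g.vec (Sum.inr j)) :
    L₁.oddSections W ⊔ Submodule.span (S.evenFn W) (Set.range fun i : {i // p i} => v i) ⊔
      L₂.oddSections W = ⊤ := by
  refine eq_top_iff.2 fun z _ => ?_
  obtain ⟨l, hl, b, hlb⟩ := HomOver.exists_app_add_sum_eq hX
    (show L₂.proj W z ∈ L₂.quotient.homog W true from ⟨z, z.2, rfl⟩)
  let l' : V.oddSections W := ⟨L₁.incl W l, hl⟩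
  have hr : z - (l' + ∑ a, b a • v a) ∈ L₂.oddSections W := by
    change ((z - (l' + ∑ a, b a • v a) : V.oddSections W) : V.obj W) ∈ L₂.carrier W
    rw [← L₂.proj_eq_zero_iff, AddSubgroupClass.coe_sub, Submodule.coe_add,
      AddSubmonoidClass.coe_finsetSum, map_sub, map_add, map_sum, hlb, sub_eq_zero]
    refine congrArg₂ _ rfl (Finset.sum_congr rfl fun a _ => ?_)
    rw [← hv]
    exact ((L₂.proj W).map_smul (b a : S.fn W) (v a)).symm
  rw [← add_sub_cancel (l' + ∑ a, b a • v a) z]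
  exact Submodule.add_mem_sup (Submodule.add_mem_sup (L₁.incl_mem l)
    (sum_mem fun a _ => Submodule.smul_mem _ _ (Submodule.subset_span ⟨a, rfl⟩))) hr

theorem exists_mul_transpose_skew_of_matrix_delta {B : V.SkewForm} (h₁ : B.IsIsotropic L₁)
    (h₂ : B.IsIsotropic L₂)
    (hX : (L₁.delta L₂).matrix e g =
      fromBlocks 1 0 0 ((S.grading W).coeMatrix (extendByOne p X)))
    {w : Fin n → V.oddSections W} (hw : pairingMatrix (B.oddForm W) (L₁.oddVec e) w = 1)
    {K : Type*} [CommRing K] {φ : S.evenFn W →+* K} (hφ : φ.mapMatrix X = 0) :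
    ∃ Y : Matrix {i // p i} {i // p i} (S.evenFn W), X * Yᵀ + Y * Xᵀ = 0 ∧ IsUnit (φ Y.det) := by
  obtain ⟨v, hv, hproj⟩ := g.exists_lift
  let v' (j : Fin n) : V.oddSections W := ⟨v (Sum.inr j), hv (Sum.inr j)⟩
  have hv' (j : Fin n) : L₂.proj W (v' j) = g.vec (Sum.inr j) := hproj (Sum.inr j)
  have hw' : pairingMatrix (B.oddForm W) (fun i : {i // p i} => L₁.oddVec e i)
      (fun i : {i // p i} => w i) = 1 := by
    rw [← submatrix_one Subtype.val Subtype.val_injective, ← hw]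
    rfl
  exact exists_mul_transpose_skew B.oddForm_comm (S.isUnit_two W) h₁.oddForm_eq_zero
    h₂.oddForm_eq_zero (fun i => L₁.incl_mem _) (oddVec_sub_sum_mem hX hv') hw'
    (oddSections_sup_span_sup_oddSections_eq_top hX hv') hφ

end AdaptedFrames

theorem exists_frames_sqrt_det {B : V.SkewForm} {L₁ L₂ : V.Subsheaf} {x : S.X}
    (hdual : B.SurjectsOntoDual L₁) (h₁ : B.IsIsotropic L₁) (h₂ : B.IsIsotropic L₂)
    (hs : L₁.fibreEven x ∩ L₂.fibreEven x = {0}) (hx : x ∈ W)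
    (e : L₁.toSuperModule.Frame m n W) (g : L₂.quotient.Frame m n W) :
    ∃ (W' : Opens S.X) (_ : x ∈ W') (e' : L₁.toSuperModule.Frame m n W')
      (g' : L₂.quotient.Frame m n W') (X K : Matrix (Fin n) (Fin n) (S.evenFn W'))
      (f c : S.evenFn W'),
      (L₁.delta L₂).matrix e' g' = fromBlocks 1 0 0 ((S.grading W').coeMatrix X) ∧ IsUnit c ∧
      f ^ 2 * c = X.det ∧ X * K = f • (1 : Matrix (Fin n) (Fin n) (S.evenFn W')) ∧
      K * X = f • (1 : Matrix (Fin n) (Fin n) (S.evenFn W')) := by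
  obtain ⟨W₁, _, hx₁, e₁, g₁, p, _, X, hX, hX₀⟩ :=
    SkewForm.exists_frames_matrix_delta_eq_extendByOne hdual hs hx e g
  obtain ⟨W₂, hW₂, w, hx₂, hw⟩ := SkewForm.exists_dual_sections hdual hx₁ e₁
  have hX₂ := HomOver.matrix_restrict_eq_fromBlocks hX hW₂
  rw [RingHom.mapMatrix_apply, map_extendByOne] at hX₂
  obtain ⟨Y, hXY, hY⟩ := exists_mul_transpose_skew_of_matrix_delta h₁ h₂ hX₂ hw
    (φ := S.eval hx₂) (by rw [RingHom.mapMatrix_apply, S.map_eval_map_res, hX₀])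
  obtain ⟨W₃, hW₃, hx₃, hu⟩ := S.exists_isUnit_of_eval_ne_zero hY.ne_zero
  let ψ := (S.evenRes hW₃).mapMatrix (m := {i // p i})
  have hX₃ := HomOver.matrix_restrict_eq_fromBlocks hX₂ hW₃
  rw [RingHom.mapMatrix_apply, map_extendByOne] at hX₃
  rw [RingHom.map_det] at hu
  obtain ⟨f, K, hf, hXK, hKX⟩ := exists_sqrt_det_of_mul_transpose_skew (S.isUnit_two W₃) hu
    (X := ψ (X.map (S.evenRes hW₂))) (by
      have hψ := congrArg ψ hXY
      rwa [map_add, map_mul, map_mul, map_zero] at hψ)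
  obtain ⟨K', hXK', hKX'⟩ := exists_extendByOne_mul_eq_smul hXK hKX
  obtain ⟨c, hc⟩ := hu.exists_right_inv
  refine ⟨W₃, hx₃, _, _, _, K', f, c, hX₃, .of_mul_eq_one_right _ hc, ?_, hXK', hKX'⟩
  rw [hf, mul_assoc, hc, mul_one, det_extendByOne]
  rfl

end SuperModule

theorem SuperModule.Subsheaf.TransversalOver.delta_surjective {S : Superspace.{u}}
    {V : SuperModule S} {L₁ L₂ : V.Subsheaf} {U W : Opens S.X} (hU : L₁.TransversalOver L₂ U)
    (h : W ≤ U) : Function.Surjective ((L₁.delta L₂).app W le_top) := by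
  intro y
  obtain ⟨v, rfl⟩ := Submodule.mkQ_surjective (L₂.carrier W) y
  obtain ⟨l₁, h₁, l₂, h₂, rfl⟩ :=
    Submodule.mem_sup.1 ((hU W h).sup_eq_top ▸ Submodule.mem_top (x := v))
  refine ⟨⟨l₁, h₁⟩, (Submodule.Quotient.eq _).2 ?_⟩
  change l₁ - (l₁ + l₂) ∈ L₂.carrier W
  rwa [sub_add_cancel_left, neg_mem_iff]

theorem theorem4p5_general {S : Superspace.{u}} {m n : ℕ} {V : SuperModule S} {B : V.SkewForm}
    {L₁ L₂ : V.Subsheaf} (hL₁ : L₁.toSuperModule.IsLocallyFree m n)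
    (hL₂ : L₂.quotient.IsLocallyFree m n) (hiso₁ : B.IsIsotropic L₁) (hiso₂ : B.IsIsotropic L₂)
    (hdual : B.SurjectsOntoDual L₁) {U : Opens S.X} (hU : L₁.TransversalOver L₂ U)
    {s : S.X} (hs : L₁.fibreEven s ∩ L₂.fibreEven s = {0}) :
    ∃ W : Opens S.X, s ∈ W ∧
      ∃ (t : SuperModule.BerSection L₁.toSuperModule L₂.quotient m n W) (f : S.evenFn W),
        t.IsTrivialization ∧
        (∀ (W' : Opens S.X) (h : W' ≤ W ⊓ U)
          (e : L₁.toSuperModule.Frame m n W') (g : L₂.quotient.Frame m n W'),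
          SuperModule.theta (L₁.delta L₂) e g *
            (S.evenRes (h.trans inf_le_left) f ^ 2 * t.coeff (h.trans inf_le_left) e g) = 1) ∧
        SuperModule.MemSupportIdeal (L₁.delta L₂) f ∧
        ∃ k : SuperModule.HomOver W L₂.quotient L₁.toSuperModule,
          ∀ (W' : Opens S.X) (h : W' ≤ W ⊓ U) (l : L₁.carrier W'),
            k.app W' (h.trans inf_le_left) ((L₁.delta L₂).app W' le_top l) =
              (S.evenRes (h.trans inf_le_left) f : S.fn W') • l := by
  obtain ⟨W₁, hs₁, ⟨e₁⟩⟩ := hL₁ s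
  obtain ⟨W₂, hs₂, ⟨g₂⟩⟩ := hL₂ s
  obtain ⟨W, hsW, e, g, X, K, f, c, hX, hc, hf, hXK, hKX⟩ :=
    SuperModule.exists_frames_sqrt_det hdual hiso₁ hiso₂ hs (Opens.mem_inf.2 ⟨hs₁, hs₂⟩)
      (e₁.restrict inf_le_left) (g₂.restrict inf_le_right)
  obtain ⟨k, hk⟩ := SuperModule.exists_homotopy hX hXK hKX
  refine ⟨W, hsW, .ofFrames e g c, f, SuperModule.BerSection.isTrivialization_ofFrames e g hc,
    fun W' h e' g' => ?_, fun x hx => ⟨W, le_rfl, k, hx, hk⟩,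
    k, fun W' h l => (hk W' (h.trans inf_le_left)).1 l⟩
  exact SuperModule.BerSection.theta_mul_sq_mul_coeff_ofFrames hX hf (h.trans inf_le_left)
    (hU.delta_surjective (h.trans inf_le_right)) e' g'

theorem theorem4p5 (S : Superspace.{u}) (m n : ℕ)
    (V : SuperModule S) (hV : V.IsSheaf) (hVrank : V.IsLocallyFree (2 * m) (2 * n))
    (B : V.SkewForm) (hB : B.IsSymplectic)
    (L₁ L₂ : V.Subsheaf)
    (hL₁ : L₁.IsSubbundle m n m n) (hL₂ : L₂.IsSubbundle m n m n)
    (hmax₁ : B.IsMaximalIsotropic L₁) (hmax₂ : B.IsMaximalIsotropic L₂)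
    (U : Opens S.X) (hU : L₁.TransversalOver L₂ U)
    (hinj : ∀ W : Opens S.X, Function.Injective (S.res (inf_le_left : W ⊓ U ≤ W)))
    (s : S.X) (hs : L₁.fibreEven s ∩ L₂.fibreEven s = {0}) :
    ∃ W : Opens S.X, s ∈ W ∧
      ∃ (t : SuperModule.BerSection L₁.toSuperModule L₂.quotient m n W) (f : S.evenFn W),
        t.IsTrivialization ∧
        -- `θ⁻¹ = f² t` over `W ∩ U`
        (∀ (W' : Opens S.X) (h : W' ≤ W ⊓ U)
          (e : L₁.toSuperModule.Frame m n W') (g : L₂.quotient.Frame m n W'),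
          SuperModule.theta (L₁.delta L₂) e g *
            (S.evenRes (h.trans inf_le_left) f ^ 2 * t.coeff (h.trans inf_le_left) e g) = 1) ∧
        SuperModule.MemSupportIdeal (L₁.delta L₂) f ∧
        -- `f δ⁻¹` extends from `W ∩ U` to a morphism over `W`
        ∃ k : SuperModule.HomOver W L₂.quotient L₁.toSuperModule,
          ∀ (W' : Opens S.X) (h : W' ≤ W ⊓ U) (l : L₁.carrier W'),
            k.app W' (h.trans inf_le_left) ((L₁.delta L₂).app W' le_top l) =
              (S.evenRes (h.trans inf_le_left) f : S.fn W') • l := by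
  exact theorem4p5_general hL₁.1 hL₂.2 hmax₁.1 hmax₂.1 hmax₁.2.2 hU hs
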